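/- **Setting.** For every sample size $n$ let $$Y=\mu+Z\nu+W\gamma+\epsilon\in\mathbb R^n,\qquad X\in\mathbb R^{n\times p},\ Z\in\mathbb R^{n\times v},\ W\in\mathbb R^{n\times r},$$ where all objects and dimensions may depend on $n$, except for the constant $\sigma_\epsilon^2>0$. Here $\nu\sim\mathcal N_v(0,\Psi)$ with $\Psi$ symmetric positive semi-definite, $\epsilon\sim\mathcal N_n(0,\sigma_\epsilon^2I_n)$, $\nu$ and $\epsilon$ are independent, and $\gamma$ is arbitrary. Let $A\in\mathbb R^{n_a\times n}$ and $B\in\mathbb R^{n_b\times n}$ have orthonormal rows with $AB^{\mathsf T}=0$, $AW=0$, $BW=0$, $BZ=0$, and let $Q=\binom AB$. The design $(\mu,X,Z,W,A,B)$ is either fixed or random and independent of $(\nu,\epsilon)$; if it is random, all conditions on it below hold almost surely, with nonrandom constants and rates. For $k\in\mathbb N$ let $\mathcal M_k$ be the collection of all $k$-element subsets of $\{1,\dots,p\}$, and for $m\in\mathcal M_k$ let $P_m^\perp$ be the orthogonal projection onto the orthogonal complement of the columns of $X$ indexed by $m$. Assume that $\mu$ is weakly sparse relative to $X$ with sparsity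 $s$ at rate $\sqrt n$: there are $S=S_n\in\mathcal M_s$ with $\|P_S^\perp\mu\|^2=o(\sqrt n)$. **Test.** For $m\in\mathcal M_u$ let $\hat\beta_m\in\mathbb R^p$ be a least-squares estimator in the regression of $QY$ on the columns of $QX$ indexed by $m$ (zero outside $m$). Given $\alpha>0$ let $$w_m=\frac{\exp(-\frac1\alpha\|QY-QX\hat\beta_m\|^2)}{\sum_{k\in\mathcal M_u}\exp(-\frac1\alpha\|QY-QX\hat\beta_k\|^2)},\qquad \hat\beta_{\mathrm{EW}}=\sum_{m\in\mathcal M_u}w_m\hat\beta_m,\qquad F_{\mathrm{EW}}=\frac{\|AY-AX\hat\beta_{\mathrm{EW}}\|^2/n_a}{\|BY-BX\hat\beta_{\mathrm{EW}}\|^2/n_b}.$$ For $\delta\in(0,1)$ let $F_{n_a,n_b,\delta}$ be the upper $\delta$ quantile of the $F_{n_a,n_b}$ distribution, and let $\phi_\delta=\mathbf 1(F_{\mathrm{EW}}>F_{n_a,n_b,\delta})$. Consider $$H_0:\ \lambda_{\max}(AZ\Psi Z^{\mathsf T}A^{\mathsf T})=0\qquad\text{against}\qquad H_1:\ \lambda_{\min}(AZ\Psi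 Z^{\mathsf T}A^{\mathsf T})=\frac h{\sqrt n}.$$ **Theorem.** Fix $\delta\in(0,1)$, $\sigma_\epsilon^2>0$ and sequences $n_a\asymp n_b\asymp n$. There is $h_0>0$, depending only on these and not on $n$, such that the following holds for every fixed $h\ge h_0$. Assume * $\lambda_{\max}(QZ\Psi Z^{\mathsf T}Q^{\mathsf T}+\sigma_\epsilon^2I_{n_a+n_b})=O(1)$ under $H_1$; * $u\le p$ for all large $n$, $\liminf_{n\to\infty}(u-s)\ge0$, and $\lim_{n\to\infty}u\log(p)/\sqrt n=0$; * $\alpha=\alpha_n$ is bounded and $\alpha\ge6\lambda_{\max}(QZ\Psi Z^{\mathsf T}Q^{\mathsf T}+\sigma_\epsilon^2I_{n_a+n_b})$ for all large $n$, where $\Psi$ is the covariance under $H_1$. Then the sum of the type I and type II errors of $\phi_\delta$ is asymptotically strictly between zero and one: there are constants $0<c_1\le c_2<1$ such that, for all large $n$, $$c_1\le\mathbb P_{H_0}(F_{\mathrm{EW}}>F_{n_a,n_b,\delta})+\mathbb P_{H_1}(F_{\mathrm{EW}}\le F_{n_a,n_b,\delta})\le c_2 .$$ -/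

import Mathlib

open MeasureTheory ProbabilityTheory Filter Asymptotics Matrix
open scoped Topology

noncomputable section

/-- Matrices with real entries carry the product (Borel) σ-algebra of their entries. -/
instance matrixMeasurableSpace {ι κ : Type*} : MeasurableSpace (Matrix ι κ ℝ) :=
  inferInstanceAs (MeasurableSpace (ι → κ → ℝ))

/-- Squared (unscaled) Euclidean norm. -/
def sqNorm {ι : Type*} [Fintype ι] (y : ι → ℝ) : ℝ := ∑ i, y i ^ 2

/-- Largest eigenvalue (used for symmetric matrices only). -/
def lamMax {ι : Type*} [Fintype ι] [DecidableEq ι] (M : Matrix ι ι ℝ) : ℝ :=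
  sSup (spectrum ℝ M)

/-- Smallest eigenvalue (used for symmetric matrices only). -/
def lamMin {ι : Type*} [Fintype ι] [DecidableEq ι] (M : Matrix ι ι ℝ) : ℝ :=
  sInf (spectrum ℝ M)

/-- `models p k` is the collection of all models with exactly `k` of the `p` covariates. -/
def models (p k : ℕ) : Finset (Finset (Fin p)) := Finset.powersetCard k Finset.univ

/-- The linear span of the columns of `X` indexed by `m`. -/
def colSpan {ι : Type*} {p : ℕ} (X : Matrix ι (Fin p) ℝ) (m : Finset (Fin p)) :
    Submodule ℝ (EuclideanSpace ℝ ι) :=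
  Submodule.span ℝ ((fun j => WithLp.toLp 2 (fun i => X i j)) '' (m : Set (Fin p)))

/-- `‖P_m^⊥ y‖²`: squared norm of the projection of `y` onto the orthogonal complement of the
columns of `X` in `m`. -/
def perpSq {ι : Type*} [Fintype ι] {p : ℕ} (X : Matrix ι (Fin p) ℝ) (m : Finset (Fin p))
    (y : ι → ℝ) : ℝ :=
  ‖(colSpan X m)ᗮ.starProjection (WithLp.toLp 2 y)‖ ^ 2

/-- `b` is a least-squares coefficient vector for the response `y` in the model `m`, regarded as
a vector of length `p` that vanishes outside `m`. -/
def IsLeastSquares {ι : Type*} [Fintype ι] {p : ℕ} (X : Matrix ι (Fin p) ℝ)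
    (m : Finset (Fin p)) (y : ι → ℝ) (b : Fin p → ℝ) : Prop :=
  (∀ j, j ∉ m → b j = 0) ∧
    ∀ c : Fin p → ℝ, (∀ j, j ∉ m → c j = 0) → sqNorm (y - X *ᵥ b) ≤ sqNorm (y - X *ᵥ c)

theorem exists_isLeastSquares {ι : Type*} [Fintype ι] {p : ℕ} (X : Matrix ι (Fin p) ℝ)
    (m : Finset (Fin p)) (y : ι → ℝ) : ∃ b, IsLeastSquares X m y b := by
  classical
  have hsq : ∀ z : ι → ℝ, sqNorm z = ‖WithLp.toLp 2 z‖ ^ 2 := by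
    intro z
    simp [sqNorm, EuclideanSpace.norm_sq_eq]
  have hlin : ∀ c : Fin p → ℝ, (∀ j, j ∉ m → c j = 0) →
      WithLp.toLp 2 (X *ᵥ c) = ∑ j ∈ m, c j • WithLp.toLp 2 (fun i => X i j) := by
    intro c hc
    ext i
    simp only [Matrix.mulVec, dotProduct, WithLp.ofLp_sum, WithLp.ofLp_smul, Finset.sum_apply,
      Pi.smul_apply, smul_eq_mul]
    rw [← Finset.sum_subset (Finset.subset_univ m) (fun j _ hj => by simp [hc j hj])]
    exact Finset.sum_congr rfl fun j _ => mul_comm _ _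
  have hproj := (colSpan X m).starProjection_apply_mem (WithLp.toLp 2 y)
  obtain ⟨b, hb⟩ := (Submodule.mem_span_image_finset_iff_exists_fun ℝ).1 hproj
  refine ⟨fun j => if hj : j ∈ m then b ⟨j, hj⟩ else 0, fun j hj => by simp [hj],
    fun c hc => ?_⟩
  rw [hsq, hsq]
  have h1 : WithLp.toLp 2 (X *ᵥ fun j => if hj : j ∈ m then b ⟨j, hj⟩ else 0)
      = (colSpan X m).starProjection (WithLp.toLp 2 y) := by
    rw [hlin _ (fun j hj => by simp [hj]), ← hb, ← Finset.sum_coe_sort m]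
    exact Finset.sum_congr rfl fun j _ => by simp
  have h2 : WithLp.toLp 2 (X *ᵥ c) ∈ colSpan X m := by
    rw [hlin c hc]
    exact Submodule.sum_mem _ fun j hj =>
      Submodule.smul_mem _ _ (Submodule.subset_span ⟨j, hj, rfl⟩)
  rw [WithLp.toLp_sub, WithLp.toLp_sub, h1]
  have h3 : ‖WithLp.toLp 2 y - (colSpan X m).starProjection (WithLp.toLp 2 y)‖
      ≤ ‖WithLp.toLp 2 y - WithLp.toLp 2 (X *ᵥ c)‖ := by
    rw [Submodule.starProjection_minimal]
    exact ciInf_le (f := fun x : colSpan X m => ‖WithLp.toLp 2 y - (x : EuclideanSpace ℝ ι)‖)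
      ⟨0, by rintro _ ⟨x, rfl⟩; positivity⟩ ⟨WithLp.toLp 2 (X *ᵥ c), h2⟩
  gcongr

/-- A least-squares estimator in the model `m`. If the columns in `m` are linearly dependent, one
of the minimizers is selected; the fitted value `X *ᵥ leastSquares X m y` does not depend on the
selection. -/
def leastSquares {ι : Type*} [Fintype ι] {p : ℕ} (X : Matrix ι (Fin p) ℝ)
    (m : Finset (Fin p)) (y : ι → ℝ) : Fin p → ℝ :=
  Classical.choose (exists_isLeastSquares X m y)

/-- The exponential weight of the model `m` among all models of size `u`. -/
def expWeight {ι : Type*} [Fintype ι] {p : ℕ} (X : Matrix ι (Fin p) ℝ) (α : ℝ) (u : ℕ)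
    (y : ι → ℝ) (m : Finset (Fin p)) : ℝ :=
  Real.exp (-(1 / α) * sqNorm (y - X *ᵥ leastSquares X m y)) /
    ∑ k ∈ models p u, Real.exp (-(1 / α) * sqNorm (y - X *ᵥ leastSquares X k y))

/-- The exponentially weighted estimator of the regression coefficients. -/
def betaEW {ι : Type*} [Fintype ι] {p : ℕ} (X : Matrix ι (Fin p) ℝ) (α : ℝ) (u : ℕ)
    (y : ι → ℝ) : Fin p → ℝ :=
  ∑ m ∈ models p u, expWeight X α u y m • leastSquares X m y

/-- The matrix `Q`, with the rows of `A` on top of the rows of `B`. -/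
def stackQ {a b n : ℕ} (A : Matrix (Fin a) (Fin n) ℝ) (B : Matrix (Fin b) (Fin n) ℝ) :
    Matrix (Fin a ⊕ Fin b) (Fin n) ℝ :=
  Matrix.fromRows A B

/-- The statistic `F_EW`, computed from the data `(X, Y)` and the matrices `A`, `B`. -/
def fEW {n p a b : ℕ} (A : Matrix (Fin a) (Fin n) ℝ) (B : Matrix (Fin b) (Fin n) ℝ)
    (X : Matrix (Fin n) (Fin p) ℝ) (α : ℝ) (u : ℕ) (Y : Fin n → ℝ) : ℝ :=
  let β := betaEW (stackQ A B * X) α u (stackQ A B *ᵥ Y)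
  (sqNorm (A *ᵥ Y - (A * X) *ᵥ β) / a) / (sqNorm (B *ᵥ Y - (B * X) *ᵥ β) / b)

/-- The `F` distribution with `a` and `b` degrees of freedom: the law of `(U / a) / (V / b)` with
`U`, `V` sums of squares of `a` and `b` independent standard normal variables. -/
def fDist (a b : ℕ) : Measure ℝ :=
  ((Measure.pi fun _ : Fin a => gaussianReal 0 1).prod
    (Measure.pi fun _ : Fin b => gaussianReal 0 1)).map
    fun z => (sqNorm z.1 / a) / (sqNorm z.2 / b)

/-- The upper `δ` quantile of the `F` distribution with `a` and `b` degrees of freedom. -/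
def fUpperQuantile (a b : ℕ) (δ : ℝ) : ℝ :=
  sInf {x : ℝ | (fDist a b).real (Set.Ioi x) ≤ δ}

/-- The test `φ_δ` rejects the null hypothesis when `F_EW` exceeds the upper `δ` quantile of the
`F` distribution. -/
def Rejects {n p a b : ℕ} (A : Matrix (Fin a) (Fin n) ℝ) (B : Matrix (Fin b) (Fin n) ℝ)
    (X : Matrix (Fin n) (Fin p) ℝ) (α : ℝ) (u : ℕ) (δ : ℝ) (Y : Fin n → ℝ) : Prop :=
  fUpperQuantile a b δ < fEW A B X α u Y

/-- The response `Y = μ + Z ν + W γ + ε`. -/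
def response {n v r : ℕ} (μ : Fin n → ℝ) (Z : Matrix (Fin n) (Fin v) ℝ)
    (W : Matrix (Fin n) (Fin r) ℝ) (ν : EuclideanSpace ℝ (Fin v)) (γ : Fin r → ℝ)
    (ε : EuclideanSpace ℝ (Fin n)) : Fin n → ℝ :=
  μ + Z *ᵥ ν.ofLp + W *ᵥ γ + ε.ofLp

/-- Under the probability measure `P`, the Gaussian linear mixed model holds with `ν ∼ N(0, Ψ)`
and `ε ∼ N(0, σsq I)`: the (possibly random) design `(μ, X, Z, W)`, together with the matrices
`A`, `B` built from it, is independent of the noise `(ν, ε)`, and `ν` is independent of `ε`.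
Nothing is assumed about the nuisance effects `γ`. The rows of `A` and `B` are orthonormal and
mutually orthogonal, both matrices annihilate `W`, and `B` also annihilates `Z`. -/
structure IsMixedModel {Ω : Type*} [MeasurableSpace Ω] (P : Measure Ω) {n p v r a b : ℕ}
    (μ : Ω → Fin n → ℝ) (X : Ω → Matrix (Fin n) (Fin p) ℝ) (Z : Ω → Matrix (Fin n) (Fin v) ℝ)
    (W : Ω → Matrix (Fin n) (Fin r) ℝ) (A : Ω → Matrix (Fin a) (Fin n) ℝ)
    (B : Ω → Matrix (Fin b) (Fin n) ℝ) (ν : Ω → EuclideanSpace ℝ (Fin v)) (γ : Ω → Fin r → ℝ)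
    (ε : Ω → EuclideanSpace ℝ (Fin n)) (Ψ : Matrix (Fin v) (Fin v) ℝ) (σsq : ℝ) : Prop where
  isProbabilityMeasure : IsProbabilityMeasure P
  measurable_design : Measurable fun ω => (μ ω, X ω, Z ω, W ω, A ω, B ω)
  measurable_nu : Measurable ν
  measurable_gamma : Measurable γ
  measurable_eps : Measurable ε
  posSemidef : Ψ.PosSemidef
  law_nu : P.map ν = multivariateGaussian 0 Ψ
  law_eps : P.map ε = multivariateGaussian 0 (σsq • (1 : Matrix (Fin n) (Fin n) ℝ))
  indep_nu_eps : IndepFun ν ε P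
  indep_design : IndepFun (fun ω => (μ ω, X ω, Z ω, W ω, A ω, B ω)) (fun ω => (ν ω, ε ω)) P
  orthonormal_A : ∀ᵐ ω ∂P, A ω * (A ω)ᵀ = 1
  orthonormal_B : ∀ᵐ ω ∂P, B ω * (B ω)ᵀ = 1
  orthogonal_A_B : ∀ᵐ ω ∂P, A ω * (B ω)ᵀ = 0
  A_mul_W : ∀ᵐ ω ∂P, A ω * W ω = 0
  B_mul_W : ∀ᵐ ω ∂P, B ω * W ω = 0
  B_mul_Z : ∀ᵐ ω ∂P, B ω * Z ω = 0

/-- Weak sparsity of `μ` relative to `X` with sparsity `s` at rate `k`, along a sequence of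
probability spaces: some model with `s n` covariates satisfies `‖P_m^⊥ μ‖² = o(k n)`. For a random
design, this holds almost surely, with a nonrandom bound. -/
def WeaklySparse {Ω : ℕ → Type*} [∀ n, MeasurableSpace (Ω n)] (P : ∀ n, Measure (Ω n))
    {p : ℕ → ℕ} (μ : ∀ n, Ω n → Fin n → ℝ) (X : ∀ n, Ω n → Matrix (Fin n) (Fin (p n)) ℝ)
    (s : ℕ → ℕ) (k : ℕ → ℝ) : Prop :=
  ∃ κ : ℕ → ℝ, κ =o[atTop] k ∧
    ∀ᶠ n in atTop, ∀ᵐ ω ∂P n, ∃ m ∈ models (p n) (s n), perpSq (X n ω) m (μ n ω) ≤ κ n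

end

-- Write `ξ_A`, `ξ_B` for the images of `Zν + ε` under `A` and `B`. The statistic is compared with
-- the oracle ratio `(‖ξ_A‖²/n_a) / (‖ξ_B‖²/n_b)`, and the oracle ratio is then studied by
-- elementary Gaussian estimates; no central limit theorem is needed.
--
-- Comparison. Suppose that every deviation `d = Rμ - RXc`, with `c` supported on a `u`-model,
-- satisfies `(ξ·d)² ≤ G‖d‖²` for `R = A, B`. Then `abs_sqNorm_residual_sub_le` is deterministic:
-- exponential weights minimize the weighted loss up to `α log |M_u|`, cross terms are absorbed into
-- half of the squared deviation, and both residual sums of squares differ from `‖ξ_A‖²`, `‖ξ_B‖²`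
-- by `O(κ + G + α log |M_u|)`, where `κ` bounds the sparse approximation error. For one model the
-- deviations lie in a space of dimension at most `u + 1`, so a chi-square tail and a union bound
-- over models give the control (`noiseLaw_not_noiseControlled_le`). Since `u log p = o(√n)`, one
-- may take `G = o(√n)`. Sums of squares are of order `n` or larger, so the statistic and the oracle
-- ratio agree up to a factor `1 + θ` with `√n θ → 0`, off an event of small probability
-- (`real_not_close_le`, `exists_rates`).
--
-- Type I error. Under the null the noise is isotropic and the oracle ratio is exactly `F`
-- distributed. Moving the threshold by the factor `1 + θ` amounts to rescaling a Gaussian vector by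
-- `√(1 + θ)`, which costs at most `√(exp(n_a θ²/2) - 1)` in probability, by a chi-square divergence
-- bound (`abs_stdPi_scale_sub_le`). This tends to zero, so the type I error tends to `δ`.
--
-- Type II error. Chernoff bounds place the quantile below `1 + O(n^(-1/2))`. Under the alternative
-- `‖ξ_A‖²` dominates `(σ² + h/√n)` times a chi-square variable, so for `h` large the oracle ratio
-- exceeds the quantile except on an event of prescribed small probability (`typeII_error_le`,
-- `signal_dominates`). The sum of errors therefore stays near `δ`.

theorem sqNorm_eq_norm_sq {ι : Type*} [Fintype ι] (y : ι → ℝ) :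
    sqNorm y = ‖WithLp.toLp 2 y‖ ^ 2 := by
  simp [sqNorm, EuclideanSpace.norm_sq_eq]

theorem sqNorm_eq_dotProduct {ι : Type*} [Fintype ι] (y : ι → ℝ) : sqNorm y = y ⬝ᵥ y := by
  simp [sqNorm, dotProduct, sq]

theorem sqNorm_nonneg {ι : Type*} [Fintype ι] (y : ι → ℝ) : 0 ≤ sqNorm y :=
  Finset.sum_nonneg fun _ _ => sq_nonneg _

@[fun_prop]
theorem measurable_sqNorm {ι : Type*} [Fintype ι] : Measurable (sqNorm (ι := ι)) := by
  unfold sqNorm; fun_prop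

@[fun_prop]
theorem continuous_sqNorm {ι : Type*} [Fintype ι] : Continuous (sqNorm (ι := ι)) := by
  unfold sqNorm; fun_prop

-- Laplace transform and tails of the chi-square distribution

/-- The standard Gaussian measure on `ι → ℝ`. -/
noncomputable abbrev stdPi (ι : Type*) [Fintype ι] : Measure (ι → ℝ) :=
  Measure.pi fun _ => gaussianReal 0 1

theorem lintegral_exp_neg_sq_gaussianReal {s : ℝ} (hs : 0 < 1 + 2 * s) :
    ∫⁻ x, ENNReal.ofReal (Real.exp (-s * x ^ 2)) ∂gaussianReal 0 1
      = ENNReal.ofReal ((√(1 + 2 * s))⁻¹) := by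
  rw [gaussianReal_of_var_ne_zero _ one_ne_zero,
    lintegral_withDensity_eq_lintegral_mul _ (measurable_gaussianPDF 0 1) (by fun_prop)]
  have h : ∀ x : ℝ, (gaussianPDF 0 1 * fun x => ENNReal.ofReal (Real.exp (-s * x ^ 2))) x
      = ENNReal.ofReal ((√(2 * Real.pi))⁻¹ * Real.exp (-(1 / 2 + s) * x ^ 2)) := by
    intro x
    simp only [Pi.mul_apply, gaussianPDF, gaussianPDFReal]
    rw [← ENNReal.ofReal_mul (by positivity), mul_assoc, ← Real.exp_add]
    congr 3
    · simp
    · simp; ring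
  simp_rw [h]
  rw [← ofReal_integral_eq_lintegral_ofReal
    ((integrable_exp_neg_mul_sq (by linarith)).const_mul _) (ae_of_all _ fun x => by positivity),
    integral_const_mul, integral_gaussian]
  congr 1
  rw [← Real.sqrt_inv, ← Real.sqrt_inv, ← Real.sqrt_mul (by positivity)]
  congr 1
  have := Real.pi_pos
  have h2 : 1 / 2 + s ≠ 0 := by linarith
  field_simp

theorem lintegral_prod_pi {ι : Type*} [Fintype ι] {E : ι → Type*} [∀ i, MeasurableSpace (E i)]
    (μ : ∀ i, Measure (E i)) [∀ i, IsProbabilityMeasure (μ i)] (f : ∀ i, E i → ENNReal)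
    (hf : ∀ i, Measurable (f i)) :
    ∫⁻ x, ∏ i, f i (x i) ∂Measure.pi μ = ∏ i, ∫⁻ x, f i x ∂μ i := by
  classical
  have h1 := iIndepFun_pi (μ := μ) (X := f) (fun i => (hf i).aemeasurable)
  rw [lintegral_prod_eq_prod_lintegral_of_indepFun Finset.univ
    (fun i (x : ∀ i, E i) => f i (x i)) h1 (fun i => (hf i).comp (measurable_pi_apply i))]
  refine Finset.prod_congr rfl fun i _ => ?_
  rw [← lintegral_map (hf i) (measurable_pi_apply i), Measure.pi_map_eval]
  simp

theorem lintegral_exp_neg_sqNorm {ι : Type*} [Fintype ι] {s : ℝ} (hs : 0 < 1 + 2 * s) :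
    ∫⁻ x, ENNReal.ofReal (Real.exp (-s * sqNorm x)) ∂stdPi ι
      = ENNReal.ofReal ((√(1 + 2 * s))⁻¹ ^ Fintype.card ι) := by
  have h : ∀ x : ι → ℝ, ENNReal.ofReal (Real.exp (-s * sqNorm x))
      = ∏ i, ENNReal.ofReal (Real.exp (-s * x i ^ 2)) := by
    intro x
    rw [← ENNReal.ofReal_prod_of_nonneg fun _ _ => by positivity, ← Real.exp_sum, sqNorm,
      Finset.mul_sum]
  simp_rw [h]
  rw [lintegral_prod_pi _ (fun _ x => ENNReal.ofReal (Real.exp (-s * x ^ 2)))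
    (fun _ => by fun_prop), lintegral_exp_neg_sq_gaussianReal hs, Finset.prod_const,
    ENNReal.ofReal_pow (by positivity), Finset.card_univ]

/-- Per coordinate, `(1 + 2s)⁻¹ = 1 - 2s/(1 + 2s) ≤ exp(-2s/(1 + 2s))`, and the exponent is at most
`2(-s + 4s²)` as soon as `s ≥ -1/4`. Both signs of `s` are allowed, so one bound serves both tails.
-/
theorem lintegral_exp_neg_sqNorm_le {ι : Type*} [Fintype ι] {s : ℝ} (hs : |s| ≤ 1 / 4) :
    ∫⁻ x, ENNReal.ofReal (Real.exp (-s * sqNorm x)) ∂stdPi ι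
      ≤ ENNReal.ofReal (Real.exp (Fintype.card ι * (-s + 4 * s ^ 2))) := by
  obtain ⟨h1, h2⟩ := abs_le.1 hs
  have h0 : 0 < 1 + 2 * s := by linarith
  rw [lintegral_exp_neg_sqNorm h0, Real.exp_nat_mul]
  gcongr
  rw [← Real.sqrt_inv]
  refine Real.sqrt_le_iff.2 ⟨by positivity, ?_⟩
  rw [← Real.exp_nat_mul]
  have h3 : (1 + 2 * s)⁻¹ = 1 + (-(2 * s) / (1 + 2 * s)) := by field_simp; ring
  rw [h3, add_comm]
  refine (Real.add_one_le_exp _).trans (Real.exp_le_exp.2 ?_)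
  rw [div_le_iff₀ h0]
  push_cast
  nlinarith [sq_nonneg s]

/-- Chernoff bounds for the chi-square distribution. -/
theorem stdPi_exp_markov {ι : Type*} [Fintype ι] {s : ℝ} (hs : |s| ≤ 1 / 4) (x : ℝ) :
    (stdPi ι).real {z | -s * x ≤ -s * sqNorm z}
      ≤ Real.exp (Fintype.card ι * (-s + 4 * s ^ 2) + s * x) := by
  refine ENNReal.toReal_le_of_le_ofReal (by positivity) ?_
  have h := meas_ge_le_lintegral_div (μ := stdPi ι)
    (f := fun z => ENNReal.ofReal (Real.exp (-s * sqNorm z))) (by fun_prop)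
    (ε := ENNReal.ofReal (Real.exp (-s * x))) (by positivity) (by simp)
  have h2 : {z : ι → ℝ | -s * x ≤ -s * sqNorm z} = {z | ENNReal.ofReal (Real.exp (-s * x))
      ≤ ENNReal.ofReal (Real.exp (-s * sqNorm z))} := by
    ext z
    simp only [Set.mem_ofPred_eq]
    rw [ENNReal.ofReal_le_ofReal_iff (by positivity), Real.exp_le_exp]
  rw [h2]
  refine h.trans ?_
  rw [Real.exp_add, show s * x = -(-s * x) by ring, Real.exp_neg, ← div_eq_mul_inv,
    ENNReal.ofReal_div_of_pos (by positivity)]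
  gcongr
  exact lintegral_exp_neg_sqNorm_le hs

theorem stdPi_upper_tail {ι : Type*} [Fintype ι] [Nonempty ι] (K : ℝ) :
    (stdPi ι).real {z | Fintype.card ι + K * √(Fintype.card ι) ≤ sqNorm z}
      ≤ Real.exp (1 / 4 - K / 4) := by
  set k : ℝ := (Fintype.card ι : ℝ) with hk
  have hk1 : 1 ≤ √k := Real.one_le_sqrt.2 (by rw [hk]; exact_mod_cast Fintype.card_pos)
  have hkk : k = √k * √k := (Real.mul_self_sqrt (by positivity)).symm
  -- With `|s| = 1/(4√k)` the quadratic term `4ks²` equals `1/4` and the deviation contributes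
  -- `K/4`; `k ≥ 1` ensures `|s| ≤ 1/4`.
  have h := stdPi_exp_markov (ι := ι) (s := -(1 / (4 * √k)))
    (by rw [abs_neg, abs_of_pos (by positivity)]; gcongr; linarith) (k + K * √k)
  have h0 : (0:ℝ) < √k := by linarith
  have h2 : ∀ a b : ℝ, -(-(1 / (4 * √k))) * a ≤ -(-(1 / (4 * √k))) * b ↔ a ≤ b := fun a b =>
    mul_le_mul_iff_right₀ (by rw [neg_neg]; positivity)
  simp only [h2] at h
  refine h.trans_eq ?_
  congr 1
  rw [← hk]
  generalize √k = r at *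
  rw [hkk]
  field_simp
  ring

theorem stdPi_lower_tail {ι : Type*} [Fintype ι] [Nonempty ι] (K : ℝ) :
    (stdPi ι).real {z | sqNorm z ≤ Fintype.card ι - K * √(Fintype.card ι)}
      ≤ Real.exp (1 / 4 - K / 4) := by
  set k : ℝ := (Fintype.card ι : ℝ) with hk
  have hk1 : 1 ≤ √k := Real.one_le_sqrt.2 (by rw [hk]; exact_mod_cast Fintype.card_pos)
  have hkk : k = √k * √k := (Real.mul_self_sqrt (by positivity)).symm
  have h := stdPi_exp_markov (ι := ι) (s := 1 / (4 * √k))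
    (by rw [abs_of_pos (by positivity)]; gcongr; linarith) (k - K * √k)
  have h0 : (0:ℝ) < √k := by linarith
  have h2 : ∀ a b : ℝ, -(1 / (4 * √k)) * a ≤ -(1 / (4 * √k)) * b ↔ b ≤ a := fun a b => by
    rw [neg_mul, neg_mul, neg_le_neg_iff]
    exact mul_le_mul_iff_right₀ (by positivity)
  simp only [h2] at h
  refine h.trans_eq ?_
  congr 1
  rw [← hk]
  generalize √k = r at *
  rw [hkk]
  field_simp
  ring

-- Rescaling a standard Gaussian vector

/-- The density of the law of `z / √(1 + θ)` with respect to that of `z`, for standard Gaussian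
`z`. -/
noncomputable def scaleDensity {ι : Type*} [Fintype ι] (θ : ℝ) (z : ι → ℝ) : ℝ :=
  √(1 + θ) ^ Fintype.card ι * Real.exp (-(θ / 2) * sqNorm z)

theorem gaussianReal_map_scale {θ : ℝ} (hθ : 0 ≤ θ) :
    (gaussianReal 0 1).map ((√(1 + θ))⁻¹ * ·) = (gaussianReal 0 1).withDensity
      fun x => ENNReal.ofReal (√(1 + θ) * Real.exp (-(θ / 2) * x ^ 2)) := by
  have h1 : (0:ℝ) < 1 + θ := by linarith
  rw [gaussianReal_map_const_mul]
  have h3 : ((NNReal.mk (((√(1 + θ))⁻¹) ^ 2) (sq_nonneg _) * 1 : NNReal) : ℝ) = (1 + θ)⁻¹ := by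
    rw [mul_one]
    change ((√(1 + θ))⁻¹) ^ 2 = _
    rw [inv_pow, Real.sq_sqrt h1.le]
  have hv : NNReal.mk (((√(1 + θ))⁻¹) ^ 2) (sq_nonneg _) * 1 ≠ 0 := by
    intro h
    rw [h] at h3
    exact (inv_pos.2 h1).ne h3
  rw [gaussianReal_of_var_ne_zero _ hv, gaussianReal_of_var_ne_zero _ one_ne_zero,
    ← withDensity_mul _ (measurable_gaussianPDF 0 1) (by fun_prop)]
  congr 1
  ext x
  simp only [Pi.mul_apply, gaussianPDF, gaussianPDFReal]
  rw [← ENNReal.ofReal_mul (by positivity)]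
  congr 1
  have hs : √(1 + θ) ≠ 0 := (Real.sqrt_pos.2 h1).ne'
  rw [h3, Real.sqrt_mul (by positivity), Real.sqrt_inv]
  simp only [mul_zero, sub_zero, NNReal.coe_one, mul_one]
  have h4 : -x ^ 2 / (2 * (1 + θ)⁻¹) = -x ^ 2 / 2 + (-(θ / 2) * x ^ 2) := by
    field_simp; ring
  rw [h4, Real.exp_add]
  field_simp

theorem measurable_scaleDensity {ι : Type*} [Fintype ι] (θ : ℝ) :
    Measurable (scaleDensity (ι := ι) θ) := by
  unfold scaleDensity; fun_prop

theorem scaleDensity_nonneg {ι : Type*} [Fintype ι] (θ : ℝ) (z : ι → ℝ) :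
    0 ≤ scaleDensity θ z := by
  unfold scaleDensity; positivity

/-- Both measures are compared on boxes, where the indicator and the density are products over
coordinates and the one-dimensional case applies. -/
theorem stdPi_map_scale {ι : Type*} [Fintype ι] {θ : ℝ} (hθ : 0 ≤ θ) :
    (stdPi ι).map (fun z => (√(1 + θ))⁻¹ • z)
      = (stdPi ι).withDensity fun z => ENNReal.ofReal (scaleDensity θ z) := by
  have h : ((fun z : ι → ℝ => (√(1 + θ))⁻¹ • z)) = fun z i => (√(1 + θ))⁻¹ * z i := by
    ext; simp
  rw [h, Measure.pi_map_pi (f := fun _ x => (√(1 + θ))⁻¹ * x) (fun _ => by fun_prop)]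
  refine Measure.pi_eq fun s hs => ?_
  rw [withDensity_apply _ (MeasurableSet.univ_pi hs),
    ← lintegral_indicator (MeasurableSet.univ_pi hs)]
  rw [gaussianReal_map_scale hθ]
  simp_rw [fun i => withDensity_apply (μ := gaussianReal 0 1)
    (fun x => ENNReal.ofReal (√(1 + θ) * Real.exp (-(θ / 2) * x ^ 2))) (hs i)]
  simp_rw [← fun i => lintegral_indicator (μ := gaussianReal 0 1) (hs i)]
  rw [← lintegral_prod_pi _ _ (fun i => Measurable.indicator (by fun_prop) (hs i))]
  refine lintegral_congr fun z => ?_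
  by_cases hz : z ∈ Set.pi Set.univ s
  · have hz' : ∀ i, z i ∈ s i := fun i => hz i (Set.mem_univ i)
    simp only [hz, Set.indicator_of_mem, hz']
    rw [← ENNReal.ofReal_prod_of_nonneg fun _ _ => by positivity, Finset.prod_mul_distrib,
      ← Real.exp_sum, ← Finset.mul_sum]
    simp [scaleDensity, sqNorm]
  · rw [Set.indicator_of_notMem hz]
    simp only [Set.mem_pi, Set.mem_univ, true_implies, not_forall] at hz
    obtain ⟨i, hi⟩ := hz
    exact (Finset.prod_eq_zero (Finset.mem_univ i) (Set.indicator_of_notMem hi _)).symm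

theorem lintegral_scaleDensity {ι : Type*} [Fintype ι] {θ : ℝ} (hθ : 0 ≤ θ) :
    ∫⁻ z, ENNReal.ofReal (scaleDensity θ z) ∂stdPi ι = 1 := by
  simp_rw [scaleDensity, ENNReal.ofReal_mul (p := √(1 + θ) ^ Fintype.card ι) (by positivity)]
  rw [lintegral_const_mul _ (by fun_prop), lintegral_exp_neg_sqNorm (by linarith),
    ← ENNReal.ofReal_mul (by positivity), ← mul_pow]
  have : √(1 + θ) ≠ 0 := (Real.sqrt_pos.2 (by linarith)).ne'
  rw [mul_div_cancel₀ _ two_ne_zero, mul_inv_cancel₀ this]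
  simp

/-- The second moment is `((1 + θ)/√(1 + 2θ))^k`, and `(1 + θ)² ≤ (1 + θ²)(1 + 2θ)`. The first-order
term in `θ` cancels; hence `√n θ → 0` suffices later. -/
theorem lintegral_scaleDensity_sq_le {ι : Type*} [Fintype ι] {θ : ℝ} (hθ : 0 ≤ θ) :
    ∫⁻ z, ENNReal.ofReal (scaleDensity θ z ^ 2) ∂stdPi ι
      ≤ ENNReal.ofReal (Real.exp (Fintype.card ι * (θ ^ 2 / 2))) := by
  have h : ∀ z : ι → ℝ, scaleDensity θ z ^ 2
      = (1 + θ) ^ Fintype.card ι * Real.exp (-θ * sqNorm z) := by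
    intro z
    rw [scaleDensity, mul_pow, ← pow_mul, mul_comm _ 2, pow_mul, Real.sq_sqrt (by linarith),
      ← Real.exp_nat_mul]
    congr 2
    push_cast; ring
  simp_rw [h, ENNReal.ofReal_mul (p := (1 + θ) ^ Fintype.card ι) (by positivity)]
  rw [lintegral_const_mul _ (by fun_prop), lintegral_exp_neg_sqNorm (by linarith),
    ← ENNReal.ofReal_mul (by positivity), ← mul_pow, Real.exp_nat_mul]
  gcongr
  rw [← div_eq_mul_inv, div_le_iff₀ (by positivity)]
  have h1 : 1 + θ ^ 2 ≤ Real.exp (θ ^ 2 / 2) ^ 2 := by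
    rw [← Real.exp_nat_mul]
    refine le_trans ?_ (Real.add_one_le_exp _)
    push_cast; linarith
  refine abs_le_of_sq_le_sq' ?_ (by positivity) |>.2
  rw [mul_pow, Real.sq_sqrt (by linarith)]
  calc (1 + θ) ^ 2 ≤ (1 + θ ^ 2) * (1 + 2 * θ) := by nlinarith [pow_nonneg hθ 3]
    _ ≤ _ := by gcongr

/-- Scaling a standard Gaussian vector by a factor near one changes probabilities by little. -/
theorem abs_stdPi_scale_sub_le {ι : Type*} [Fintype ι] {θ : ℝ} (hθ : 0 ≤ θ) {T : Set (ι → ℝ)}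
    (hT : MeasurableSet T) :
    |(stdPi ι).real {z | (√(1 + θ))⁻¹ • z ∈ T} - (stdPi ι).real T|
      ≤ √(Real.exp (Fintype.card ι * (θ ^ 2 / 2)) - 1) := by
  set g : (ι → ℝ) → ℝ := scaleDensity θ with hg
  have hgm : Measurable g := measurable_scaleDensity θ
  have hg0 : ∀ z, 0 ≤ g z := scaleDensity_nonneg θ
  have hgi : Integrable g (stdPi ι) := by
    refine ⟨hgm.aestronglyMeasurable, ?_⟩
    rw [hasFiniteIntegral_iff_ofReal (ae_of_all _ hg0), lintegral_scaleDensity hθ]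
    simp
  have hg2i : Integrable (fun z => g z ^ 2) (stdPi ι) := by
    refine ⟨(hgm.pow_const 2).aestronglyMeasurable, ?_⟩
    rw [hasFiniteIntegral_iff_ofReal (ae_of_all _ fun z => by positivity)]
    exact (lintegral_scaleDensity_sq_le hθ).trans_lt ENNReal.ofReal_lt_top
  have hint : ∫ z, g z ∂stdPi ι = 1 := by
    rw [integral_eq_lintegral_of_nonneg_ae (ae_of_all _ hg0) hgm.aestronglyMeasurable,
      lintegral_scaleDensity hθ]
    simp
  have hint2 : ∫ z, g z ^ 2 ∂stdPi ι ≤ Real.exp (Fintype.card ι * (θ ^ 2 / 2)) := by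
    rw [integral_eq_lintegral_of_nonneg_ae (ae_of_all _ fun z => by positivity)
      (hgm.pow_const 2).aestronglyMeasurable]
    exact ENNReal.toReal_le_of_le_ofReal (by positivity) (lintegral_scaleDensity_sq_le hθ)
  have h1 : (stdPi ι).real {z | (√(1 + θ))⁻¹ • z ∈ T} = ∫ z in T, g z ∂stdPi ι := by
    have : (stdPi ι) {z | (√(1 + θ))⁻¹ • z ∈ T}
        = ((stdPi ι).map (fun z => (√(1 + θ))⁻¹ • z)) T := by
      rw [Measure.map_apply (by fun_prop) hT]; rfl
    rw [Measure.real, this, stdPi_map_scale hθ, withDensity_apply _ hT,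
      integral_eq_lintegral_of_nonneg_ae (ae_of_all _ hg0) hgm.aestronglyMeasurable]
  have h2 : (stdPi ι).real T = ∫ z in T, (1 : ℝ) ∂stdPi ι := by simp
  have hdi : Integrable (fun z => g z - 1) (stdPi ι) := hgi.sub (integrable_const 1)
  rw [h1, h2, ← integral_sub hgi.integrableOn (integrable_const _)]
  have hL2 : MemLp (fun z => |g z - 1|) 2 (stdPi ι) := by
    refine (memLp_two_iff_integrable_sq (by fun_prop)).2 ?_
    simp only [sq_abs, sub_sq, mul_one, one_pow]
    exact (hg2i.sub (hgi.const_mul 2)).add (integrable_const 1)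
  -- Cauchy–Schwarz in the form of a nonnegative variance: `(E|g - 1|)² ≤ E(g - 1)² = E g² - 1`.
  have hvar := variance_nonneg (fun z => |g z - 1|) (stdPi ι)
  rw [variance_eq_sub hL2] at hvar
  have h3 : ∫ z, (|g z - 1|) ^ 2 ∂stdPi ι = ∫ z, g z ^ 2 ∂stdPi ι - 1 := by
    simp only [sq_abs, sub_sq, mul_one, one_pow]
    have e : Integrable (fun z => g z ^ 2 - 2 * g z) (stdPi ι) := hg2i.sub (hgi.const_mul 2)
    rw [integral_add e (integrable_const 1), integral_sub hg2i (hgi.const_mul 2),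
      integral_const_mul, hint]
    simp; ring
  simp only [Pi.pow_apply] at hvar
  rw [h3] at hvar
  calc |∫ z in T, (g z - 1) ∂stdPi ι| ≤ ∫ z in T, |g z - 1| ∂stdPi ι := abs_integral_le_integral_abs
    _ ≤ ∫ z, |g z - 1| ∂stdPi ι :=
        setIntegral_le_integral hdi.abs (ae_of_all _ fun z => abs_nonneg _)
    _ ≤ _ := Real.le_sqrt_of_sq_le (by linarith)

/-! ### The `F` distribution -/

theorem measurable_fRatio (a b : ℕ) :
    Measurable fun z : (Fin a → ℝ) × (Fin b → ℝ) => (sqNorm z.1 / a) / (sqNorm z.2 / b) := by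
  fun_prop

instance isProbabilityMeasure_fDist (a b : ℕ) : IsProbabilityMeasure (fDist a b) :=
  Measure.isProbabilityMeasure_map (measurable_fRatio a b).aemeasurable

theorem fDist_real_Ioi (a b : ℕ) (x : ℝ) : (fDist a b).real (Set.Ioi x)
    = ((stdPi (Fin a)).prod (stdPi (Fin b))).real
      {z | x < (sqNorm z.1 / a) / (sqNorm z.2 / b)} := by
  rw [fDist, map_measureReal_apply (measurable_fRatio a b) measurableSet_Ioi]
  rfl

/-- Fubini over the second factor. It allows the numerator of the `F` ratio to be rescaled with the
denominator frozen. -/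
theorem abs_prod_real_sub_le {α β : Type*} [MeasurableSpace α] [MeasurableSpace β]
    (P : Measure α) (ρ : Measure β) [IsProbabilityMeasure P] [IsProbabilityMeasure ρ]
    {S T : Set (α × β)} (hS : MeasurableSet S) (hT : MeasurableSet T) {c : ℝ}
    (h : ∀ y, |P.real {x | (x, y) ∈ S} - P.real {x | (x, y) ∈ T}| ≤ c) :
    |(P.prod ρ).real S - (P.prod ρ).real T| ≤ c := by
  have key : ∀ U : Set (α × β), MeasurableSet U →
      (P.prod ρ).real U = (∫ y, P.real {x | (x, y) ∈ U} ∂ρ) ∧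
      Integrable (fun y => P.real {x | (x, y) ∈ U}) ρ := by
    intro U hU
    have hm : Measurable fun y => P {x | (x, y) ∈ U} := measurable_measure_prodMk_right hU
    refine ⟨?_, ?_⟩
    · rw [Measure.real, Measure.prod_apply_symm hU, integral_eq_lintegral_of_nonneg_ae
        (ae_of_all _ fun _ => measureReal_nonneg) hm.ennreal_toReal.aestronglyMeasurable]
      congr 1
      refine lintegral_congr fun y => ?_
      rw [ofReal_measureReal]; rfl
    · refine Integrable.of_bound hm.ennreal_toReal.aestronglyMeasurable 1 (ae_of_all _ fun y => ?_)
      change ‖P.real _‖ ≤ 1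
      rw [Real.norm_of_nonneg measureReal_nonneg]
      exact measureReal_le_one
  rw [(key S hS).1, (key T hT).1, ← integral_sub (key S hS).2 (key T hT).2]
  refine (abs_integral_le_integral_abs).trans ?_
  refine (integral_mono ((key S hS).2.sub (key T hT).2).abs (integrable_const c) h).trans ?_
  simp

/-- For a fixed denominator, multiplying the threshold by `1 + θ` is the same as dividing the
Gaussian vector in the numerator by `√(1 + θ)`. This quantitative continuity of the `F` distribution
is uniform in `x` and in `b`. -/
theorem abs_fDist_scale_sub_le (a b : ℕ) {θ : ℝ} (hθ : 0 ≤ θ) (x : ℝ) :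
    |(fDist a b).real (Set.Ioi (x * (1 + θ))) - (fDist a b).real (Set.Ioi x)|
      ≤ √(Real.exp (a * (θ ^ 2 / 2)) - 1) := by
  have h1 : (0:ℝ) < 1 + θ := by linarith
  rw [fDist_real_Ioi, fDist_real_Ioi]
  refine abs_prod_real_sub_le _ _ (measurableSet_lt measurable_const (measurable_fRatio a b))
    (measurableSet_lt measurable_const (measurable_fRatio a b)) fun y => ?_
  have h := abs_stdPi_scale_sub_le (ι := Fin a) hθ
    (T := {z | x < (sqNorm z / a) / (sqNorm y / b)})
    (measurableSet_lt measurable_const (by fun_prop))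
  rw [Fintype.card_fin] at h
  refine le_trans (le_of_eq ?_) h
  congr 4
  ext z
  have h2 : sqNorm ((√(1 + θ))⁻¹ • z) = sqNorm z / (1 + θ) := by
    simp only [sqNorm, Pi.smul_apply, smul_eq_mul, mul_pow, ← Finset.mul_sum, inv_pow,
      Real.sq_sqrt h1.le]
    ring
  simp only [Set.mem_ofPred_eq, h2]
  rw [show sqNorm z / (1 + θ) / a / (sqNorm y / b) = (sqNorm z / a / (sqNorm y / b)) / (1 + θ) by
    ring, lt_div_iff₀ h1]

-- Linear images of Gaussian vectors and the law of the noise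

theorem inner_toLp_mulVec {ι κ : Type*} [Fintype ι] [Fintype κ] (L : Matrix κ ι ℝ) (z : ι → ℝ)
    (t : EuclideanSpace ℝ κ) :
    inner ℝ (WithLp.toLp 2 (L *ᵥ z)) t
      = inner ℝ (WithLp.toLp 2 z) (WithLp.toLp 2 (Lᵀ *ᵥ t.ofLp)) := by
  simp only [EuclideanSpace.inner_eq_star_dotProduct, star_trivial]
  rw [dotProduct_mulVec, mulVec_transpose]

@[fun_prop]
theorem measurable_mulVec_const {ι κ : Type*} [Fintype ι] (L : Matrix κ ι ℝ) :
    Measurable fun z : ι → ℝ => L *ᵥ z := by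
  refine measurable_pi_iff.2 fun i => ?_
  simp only [mulVec, dotProduct]
  fun_prop

theorem stdPi_map_mulVec {ι κ : Type*} [Fintype ι] [Fintype κ] [DecidableEq κ]
    {L : Matrix κ ι ℝ} {S : Matrix κ κ ℝ} (hS : L * Lᵀ = S) :
    (stdPi ι).map (fun z => WithLp.toLp 2 (L *ᵥ z)) = multivariateGaussian 0 S := by
  have hpos : S.PosSemidef := by
    rw [← hS]; simpa using posSemidef_self_mul_conjTranspose L
  have hm : Measurable fun z : ι → ℝ => WithLp.toLp 2 (L *ᵥ z) := by fun_prop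
  have := Measure.isProbabilityMeasure_map (μ := stdPi ι) hm.aemeasurable
  refine Measure.ext_of_charFun ?_
  ext t
  rw [charFun_multivariateGaussian hpos, charFun_apply, integral_map hm.aemeasurable (by fun_prop)]
  simp_rw [inner_toLp_mulVec]
  have h := charFun_stdGaussian (WithLp.toLp 2 (Lᵀ *ᵥ t.ofLp))
  rw [← map_pi_eq_stdGaussian, charFun_apply, integral_map (by fun_prop) (by fun_prop)] at h
  rw [h]
  congr 1
  have h2 : t.ofLp ⬝ᵥ S *ᵥ t.ofLp = ‖WithLp.toLp 2 (Lᵀ *ᵥ t.ofLp)‖ ^ 2 := by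
    rw [← sqNorm_eq_norm_sq, sqNorm_eq_dotProduct, ← hS, ← mulVec_mulVec, dotProduct_mulVec,
      ← mulVec_transpose]
  rw [h2]
  push_cast
  simp [neg_div]

/-- A centred Gaussian law is determined by its covariance `L * Lᵀ`, whatever the dimension of the
source. -/
theorem stdPi_map_mulVec_congr {ι ι' κ : Type*} [Fintype ι] [Fintype ι'] [Fintype κ]
    {L : Matrix κ ι ℝ} {L' : Matrix κ ι' ℝ} (h : L * Lᵀ = L' * L'ᵀ) :
    (stdPi ι).map (fun z => L *ᵥ z) = (stdPi ι').map (fun z => L' *ᵥ z) := by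
  classical
  have h1 := (stdPi_map_mulVec h).trans (stdPi_map_mulVec (rfl : L' * L'ᵀ = _)).symm
  have h2 := congrArg (Measure.map (WithLp.ofLp (p := 2))) h1
  rwa [Measure.map_map (by fun_prop) (by fun_prop), Measure.map_map (by fun_prop) (by fun_prop)]
    at h2

/-- The law of the noise `(ν, ε)` in the mixed model. -/
noncomputable abbrev noiseLaw {v n : ℕ} (Ψ : Matrix (Fin v) (Fin v) ℝ) (σsq : ℝ) :
    Measure (EuclideanSpace ℝ (Fin v) × EuclideanSpace ℝ (Fin n)) :=
  (multivariateGaussian 0 Ψ).prod (multivariateGaussian 0 (σsq • (1 : Matrix (Fin n) (Fin n) ℝ)))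

/-- The noise vector transformed by `R`. -/
noncomputable def noiseVec {n v : ℕ} {κ : Type*} (R : Matrix κ (Fin n) ℝ)
    (Z : Matrix (Fin n) (Fin v) ℝ) (x : EuclideanSpace ℝ (Fin v) × EuclideanSpace ℝ (Fin n)) : κ → ℝ :=
  R *ᵥ (Z *ᵥ x.1.ofLp + x.2.ofLp)

@[fun_prop]
theorem measurable_noiseVec {n v : ℕ} {κ : Type*} (R : Matrix κ (Fin n) ℝ)
    (Z : Matrix (Fin n) (Fin v) ℝ) : Measurable (noiseVec R Z) := by
  unfold noiseVec
  have h1 : Measurable fun x : EuclideanSpace ℝ (Fin v) × EuclideanSpace ℝ (Fin n) =>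
      Z *ᵥ x.1.ofLp + x.2.ofLp := by fun_prop
  exact (measurable_mulVec_const R).comp h1

/-- The covariance of the transformed noise. -/
noncomputable def noiseCov {n v : ℕ} {κ : Type*} [DecidableEq κ] (R : Matrix κ (Fin n) ℝ)
    (Z : Matrix (Fin n) (Fin v) ℝ) (Ψ : Matrix (Fin v) (Fin v) ℝ) (σsq : ℝ) : Matrix κ κ ℝ :=
  R * Z * Ψ * Zᵀ * Rᵀ + σsq • 1

theorem posSemidef_signalCov {n v : ℕ} {κ : Type*} [Fintype κ]
    (R : Matrix κ (Fin n) ℝ) (Z : Matrix (Fin n) (Fin v) ℝ) {Ψ : Matrix (Fin v) (Fin v) ℝ}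
    (hΨ : Ψ.PosSemidef) : (R * Z * Ψ * Zᵀ * Rᵀ).PosSemidef := by
  simpa [Matrix.mul_assoc] using hΨ.mul_mul_conjTranspose_same (R * Z)

theorem posSemidef_smul_one {κ : Type*} [Fintype κ] [DecidableEq κ] {σsq : ℝ} (hσ : 0 ≤ σsq) :
    (σsq • (1 : Matrix κ κ ℝ)).PosSemidef :=
  PosSemidef.one.smul hσ

theorem posSemidef_noiseCov {n v : ℕ} {κ : Type*} [Fintype κ] [DecidableEq κ]
    (R : Matrix κ (Fin n) ℝ) (Z : Matrix (Fin n) (Fin v) ℝ) {Ψ : Matrix (Fin v) (Fin v) ℝ}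
    {σsq : ℝ} (hΨ : Ψ.PosSemidef) (hσ : 0 ≤ σsq) : (noiseCov R Z Ψ σsq).PosSemidef :=
  (posSemidef_signalCov R Z hΨ).add (posSemidef_smul_one hσ)

/-- The characteristic function factorizes by independence of `ν` and `ε`; the orthonormal rows of
`R` turn the covariance of `Rε` into `σsq • 1`. -/
theorem noiseLaw_map {n v : ℕ} {κ : Type*} [Fintype κ] [DecidableEq κ]
    {R : Matrix κ (Fin n) ℝ} (hR : R * Rᵀ = 1) (Z : Matrix (Fin n) (Fin v) ℝ)
    {Ψ : Matrix (Fin v) (Fin v) ℝ} {σsq : ℝ} (hΨ : Ψ.PosSemidef) (hσ : 0 ≤ σsq) :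
    (noiseLaw Ψ σsq).map (fun x => WithLp.toLp 2 (noiseVec R Z x))
      = multivariateGaussian 0 (noiseCov R Z Ψ σsq) := by
  have hm : Measurable fun x => WithLp.toLp 2 (noiseVec R Z x) := by fun_prop
  have := Measure.isProbabilityMeasure_map (μ := noiseLaw (n := n) Ψ σsq) hm.aemeasurable
  refine Measure.ext_of_charFun ?_
  ext t
  rw [charFun_multivariateGaussian (posSemidef_noiseCov R Z hΨ hσ), charFun_apply,
    integral_map hm.aemeasurable (by fun_prop)]
  have h1 : ∀ x : EuclideanSpace ℝ (Fin v) × EuclideanSpace ℝ (Fin n),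
      Complex.exp (inner ℝ (WithLp.toLp 2 (noiseVec R Z x)) t * Complex.I)
      = Complex.exp (inner ℝ x.1 (WithLp.toLp 2 ((R * Z)ᵀ *ᵥ t.ofLp)) * Complex.I)
        * Complex.exp (inner ℝ x.2 (WithLp.toLp 2 (Rᵀ *ᵥ t.ofLp)) * Complex.I) := by
    intro x
    rw [noiseVec, mulVec_add, mulVec_mulVec, WithLp.toLp_add, inner_add_left, inner_toLp_mulVec,
      inner_toLp_mulVec, ← Complex.exp_add]
    congr 1
    push_cast
    ring
  simp_rw [h1]
  rw [integral_prod_mul (f := fun x =>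
      Complex.exp (inner ℝ x (WithLp.toLp 2 ((R * Z)ᵀ *ᵥ t.ofLp)) * Complex.I))
      (g := fun x => Complex.exp (inner ℝ x (WithLp.toLp 2 (Rᵀ *ᵥ t.ofLp)) * Complex.I)),
    ← charFun_apply, ← charFun_apply, charFun_multivariateGaussian hΨ,
    charFun_multivariateGaussian (posSemidef_smul_one hσ), ← Complex.exp_add]
  congr 1
  have h2 : t.ofLp ⬝ᵥ noiseCov R Z Ψ σsq *ᵥ t.ofLp
      = ((R * Z)ᵀ *ᵥ t.ofLp) ⬝ᵥ Ψ *ᵥ ((R * Z)ᵀ *ᵥ t.ofLp)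
        + (Rᵀ *ᵥ t.ofLp) ⬝ᵥ (σsq • (1 : Matrix (Fin n) (Fin n) ℝ)) *ᵥ (Rᵀ *ᵥ t.ofLp) := by
    have h3 : noiseCov R Z Ψ σsq
        = (R * Z) * (Ψ * (R * Z)ᵀ) + R * ((σsq • (1 : Matrix (Fin n) (Fin n) ℝ)) * Rᵀ) := by
      rw [noiseCov]
      congr 1
      · simp [Matrix.mul_assoc]
      · simp [hR]
    rw [h3, add_mulVec, dotProduct_add]
    congr 1 <;>
    rw [← mulVec_mulVec, dotProduct_mulVec, ← mulVec_transpose, ← mulVec_mulVec]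
  rw [h2]
  push_cast
  simp
  ring

theorem noiseLaw_map_noiseVec {n v : ℕ} {κ ι : Type*} [Fintype κ] [DecidableEq κ] [Fintype ι]
    {R : Matrix κ (Fin n) ℝ} (hR : R * Rᵀ = 1) (Z : Matrix (Fin n) (Fin v) ℝ)
    {Ψ : Matrix (Fin v) (Fin v) ℝ} {σsq : ℝ} (hΨ : Ψ.PosSemidef) (hσ : 0 ≤ σsq)
    {L : Matrix κ ι ℝ} (hL : L * Lᵀ = noiseCov R Z Ψ σsq) :
    (noiseLaw Ψ σsq).map (noiseVec R Z) = (stdPi ι).map (fun z => L *ᵥ z) := by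
  have h1 := (noiseLaw_map hR Z hΨ hσ).trans (stdPi_map_mulVec hL).symm
  have h2 := congrArg (Measure.map (WithLp.ofLp (p := 2))) h1
  rwa [Measure.map_map (by fun_prop) (by fun_prop), Measure.map_map (by fun_prop) (by fun_prop)]
    at h2

/-- The symmetric square root. Symmetry matters for the norm bounds below, where `‖L z‖² = zᵀ S z`
is used. -/
theorem exists_mul_transpose_eq {κ : Type*} [Fintype κ] {S : Matrix κ κ ℝ}
    (hS : S.PosSemidef) : ∃ L : Matrix κ κ ℝ, L * Lᵀ = S ∧ Lᵀ = L := by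
  classical
  open scoped MatrixOrder in
  have h1 : (CFC.sqrt S)ᴴ = CFC.sqrt S := (CFC.sqrt_nonneg S).isSelfAdjoint
  have h2 : CFC.sqrt S * CFC.sqrt S = S := CFC.sqrt_mul_sqrt_self S hS.nonneg
  rw [conjTranspose_eq_transpose_of_trivial] at h1
  exact ⟨CFC.sqrt S, by rw [h1, h2], h1⟩

/-! ### Tail bounds for projections -/

/-- The supremum of `⟨z, w⟩²/‖w‖²` over nonzero `w ∈ K` is the squared norm of the projection of `z`
onto `K`. Its coordinates in an orthonormal basis are independent standard normal, so it is
chi-square with `dim K` degrees of freedom; the Chernoff bound is taken at `s = -1/4`. -/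
theorem stdPi_subspace_tail {ι : Type*} [Fintype ι] (K : Submodule ℝ (EuclideanSpace ℝ ι)) {d : ℕ}
    (hd : Module.finrank ℝ K ≤ d) (x : ℝ) :
    (stdPi ι).real {z | ∃ w ∈ K, x * ‖w‖ ^ 2 < (inner ℝ (WithLp.toLp 2 z) w) ^ 2}
      ≤ Real.exp (d / 2 - x / 4) := by
  set k := Module.finrank ℝ K with hk
  let e := stdOrthonormalBasis ℝ K
  let L : Matrix (Fin k) ι ℝ := Matrix.of fun i j => (e i : EuclideanSpace ℝ ι) j
  have hL : L * Lᵀ = (1 : Matrix (Fin k) (Fin k) ℝ) * (1 : Matrix (Fin k) (Fin k) ℝ)ᵀ := by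
    ext i j
    have h := (orthonormal_iff_ite.1 e.orthonormal) j i
    rw [Submodule.coe_inner, EuclideanSpace.inner_eq_star_dotProduct] at h
    rw [transpose_one, Matrix.mul_one, Matrix.one_apply]
    simp only [mul_apply, transpose_apply, L, Matrix.of_apply]
    simp only [star_trivial, dotProduct] at h
    rw [h]
    simp [eq_comm]
  have hlaw := stdPi_map_mulVec_congr hL
  simp only [one_mulVec, Measure.map_id'] at hlaw
  have hcoord : ∀ (z : ι → ℝ) i, (L *ᵥ z) i
      = inner ℝ (e i : EuclideanSpace ℝ ι) (WithLp.toLp 2 z) := by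
    intro z i
    rw [EuclideanSpace.inner_eq_star_dotProduct, star_trivial, dotProduct_comm]
    rfl
  have hsub : {z : ι → ℝ | ∃ w ∈ K, x * ‖w‖ ^ 2 < (inner ℝ (WithLp.toLp 2 z) w) ^ 2}
      ⊆ (fun z => L *ᵥ z) ⁻¹' {y | x ≤ sqNorm y} := by
    rintro z ⟨w, hw, hlt⟩
    simp only [Set.mem_preimage, Set.mem_ofPred_eq]
    by_contra! hcon
    refine hlt.not_ge ?_
    have hw' : w = ∑ i, inner ℝ (e i : EuclideanSpace ℝ ι) w • (e i : EuclideanSpace ℝ ι) := by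
      have := congrArg (fun y : K => (y : EuclideanSpace ℝ ι)) (e.sum_repr' ⟨w, hw⟩)
      simpa using this.symm
    have hn : ‖w‖ ^ 2 = ∑ i, (inner ℝ (e i : EuclideanSpace ℝ ι) w) ^ 2 := by
      have := e.sum_sq_norm_inner_right ⟨w, hw⟩
      simpa using this.symm
    have hi : inner ℝ (WithLp.toLp 2 z) w
        = ∑ i, (L *ᵥ z) i * inner ℝ (e i : EuclideanSpace ℝ ι) w := by
      conv_lhs => rw [hw', inner_sum]
      refine Finset.sum_congr rfl fun i _ => ?_
      rw [inner_smul_right, hcoord, mul_comm]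
      congr 1
      exact real_inner_comm _ _
    rw [hi]
    refine (Finset.sum_mul_sq_le_sq_mul_sq _ _ _).trans ?_
    rw [hn]
    refine mul_le_mul_of_nonneg_right hcon.le (Finset.sum_nonneg fun _ _ => sq_nonneg _)
  refine (measureReal_mono hsub).trans ?_
  have hms : MeasurableSet {y : Fin k → ℝ | x ≤ sqNorm y} :=
    measurableSet_le measurable_const measurable_sqNorm
  rw [← map_measureReal_apply (by fun_prop) hms, hlaw]
  have h := stdPi_exp_markov (ι := Fin k) (s := -(1 / 4)) (by norm_num) x
  have hset : {y : Fin k → ℝ | x ≤ sqNorm y}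
      = {y | - -(1 / 4 : ℝ) * x ≤ - -(1 / 4) * sqNorm y} := by
    ext y
    simp only [Set.mem_ofPred_eq]
    constructor <;> intro h <;> linarith
  rw [hset]
  refine h.trans (Real.exp_le_exp.2 ?_)
  have : (k : ℝ) ≤ d := by exact_mod_cast hd
  rw [Fintype.card_fin]
  linarith

/-- Since `⟨L z, w⟩ = ⟨z, Lᵀ w⟩`, the problem moves to the image of `K` under `Lᵀ`, whose dimension
is no larger; the norm bound on `Lᵀ` replaces `G` by `G / lam`. -/
theorem stdPi_mulVec_subspace_tail {ι κ : Type*} [Fintype ι] [Fintype κ] (L : Matrix κ ι ℝ)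
    (K : Submodule ℝ (κ → ℝ)) {d : ℕ} (hd : Module.finrank ℝ K ≤ d) {lam G : ℝ}
    (hlam : 0 < lam) (hG : 0 ≤ G) (hL : ∀ w, sqNorm (Lᵀ *ᵥ w) ≤ lam * sqNorm w) :
    (stdPi ι).real {z | ∃ w ∈ K, G * sqNorm w < ((L *ᵥ z) ⬝ᵥ w) ^ 2}
      ≤ Real.exp (d / 2 - G / (4 * lam)) := by
  let f : (κ → ℝ) →ₗ[ℝ] EuclideanSpace ℝ ι :=
    (WithLp.linearEquiv 2 ℝ (ι → ℝ)).symm.toLinearMap ∘ₗ (Matrix.mulVecLin Lᵀ)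
  have hf : ∀ w, f w = WithLp.toLp 2 (Lᵀ *ᵥ w) := fun w => rfl
  have h := stdPi_subspace_tail (K.map f) ((Submodule.finrank_map_le f K).trans hd) (G / lam)
  rw [div_div, mul_comm lam 4] at h
  refine (measureReal_mono ?_).trans h
  rintro z ⟨w, hw, hlt⟩
  refine ⟨f w, Submodule.mem_map_of_mem hw, ?_⟩
  rw [hf, ← sqNorm_eq_norm_sq]
  have h2 := inner_toLp_mulVec L z (WithLp.toLp 2 w)
  rw [EuclideanSpace.inner_eq_star_dotProduct, star_trivial, dotProduct_comm] at h2
  rw [← h2]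
  refine lt_of_le_of_lt ?_ hlt
  calc G / lam * sqNorm (Lᵀ *ᵥ w) ≤ G / lam * (lam * sqNorm w) := by gcongr; exact hL w
    _ = G * sqNorm w := by field_simp

theorem noiseLaw_subspace_tail {n v : ℕ} {κ : Type*} [Fintype κ] [DecidableEq κ]
    {R : Matrix κ (Fin n) ℝ} (hR : R * Rᵀ = 1) (Z : Matrix (Fin n) (Fin v) ℝ)
    {Ψ : Matrix (Fin v) (Fin v) ℝ} {σsq : ℝ} (hΨ : Ψ.PosSemidef) (hσ : 0 ≤ σsq)
    (K : Submodule ℝ (κ → ℝ)) {d : ℕ} (hd : Module.finrank ℝ K ≤ d) {lam G : ℝ}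
    (hlam : 0 < lam) (hG : 0 ≤ G) (hS : ∀ w, w ⬝ᵥ noiseCov R Z Ψ σsq *ᵥ w ≤ lam * sqNorm w) :
    (noiseLaw Ψ σsq).real {x | ∃ w ∈ K, G * sqNorm w < (noiseVec R Z x ⬝ᵥ w) ^ 2}
      ≤ Real.exp (d / 2 - G / (4 * lam)) := by
  obtain ⟨L, hL, -⟩ := exists_mul_transpose_eq (posSemidef_noiseCov R Z hΨ hσ)
  -- An uncountable union over `w`, but of open sets, hence measurable; this is why the inequality
  -- in the event is strict.
  have hopen : IsOpen {y : κ → ℝ | ∃ w ∈ K, G * sqNorm w < (y ⬝ᵥ w) ^ 2} := by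
    have : {y : κ → ℝ | ∃ w ∈ K, G * sqNorm w < (y ⬝ᵥ w) ^ 2}
        = ⋃ w ∈ K, {y | G * sqNorm w < (y ⬝ᵥ w) ^ 2} := by ext; simp
    rw [this]
    refine isOpen_biUnion fun w _ => isOpen_lt continuous_const ?_
    simp only [dotProduct]
    fun_prop
  have h1 := map_measureReal_apply (μ := noiseLaw Ψ σsq) (measurable_noiseVec R Z)
    hopen.measurableSet
  rw [noiseLaw_map_noiseVec hR Z hΨ hσ hL, map_measureReal_apply (by fun_prop) hopen.measurableSet]
    at h1
  refine h1.symm.trans_le (stdPi_mulVec_subspace_tail L K hd hlam hG fun w => ?_)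
  rw [sqNorm_eq_dotProduct]
  refine le_trans (le_of_eq ?_) (hS w)
  rw [← hL, ← mulVec_mulVec, dotProduct_mulVec, dotProduct_mulVec, ← mulVec_transpose,
    ← mulVec_transpose]
  rw [dotProduct_mulVec, ← mulVec_transpose]

-- Deterministic analysis of exponential weighting

theorem sqNorm_add {ι : Type*} [Fintype ι] (x y : ι → ℝ) :
    sqNorm (x + y) = sqNorm x + 2 * (x ⬝ᵥ y) + sqNorm y := by
  simp only [sqNorm, dotProduct, Finset.mul_sum, ← Finset.sum_add_distrib, Pi.add_apply]
  exact Finset.sum_congr rfl fun i _ => by ring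

theorem sqNorm_sumElim {ι κ : Type*} [Fintype ι] [Fintype κ] (x : ι → ℝ) (y : κ → ℝ) :
    sqNorm (Sum.elim x y) = sqNorm x + sqNorm y := by
  simp [sqNorm, Fintype.sum_sum_type]

theorem sqNorm_smul {ι : Type*} [Fintype ι] (c : ℝ) (x : ι → ℝ) :
    sqNorm (c • x) = c ^ 2 * sqNorm x := by
  simp [sqNorm, mul_pow, Finset.mul_sum]

theorem sqNorm_sum_smul_le {ι M : Type*} [Fintype ι] (s : Finset M) (w : M → ℝ)
    (hw : ∀ m ∈ s, 0 ≤ w m) (h1 : ∑ m ∈ s, w m = 1) (v : M → ι → ℝ) :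
    sqNorm (∑ m ∈ s, w m • v m) ≤ ∑ m ∈ s, w m * sqNorm (v m) := by
  simp only [sqNorm, Finset.mul_sum]
  rw [Finset.sum_comm]
  refine Finset.sum_le_sum fun i _ => ?_
  have := (even_two.convexOn_pow (𝕜 := ℝ)).map_sum_le hw h1
    (p := fun m => v m i) (fun _ _ => Set.mem_univ _)
  simpa using this

/-- Exponential weights nearly minimize the weighted loss. -/
theorem sum_expWeights_mul_le {M : Type*} (s : Finset M) (r : M → ℝ) {α : ℝ} (hα : 0 < α)
    {m₀ : M} (hm₀ : m₀ ∈ s) :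
    ∑ m ∈ s, Real.exp (-(1 / α) * r m) / (∑ k ∈ s, Real.exp (-(1 / α) * r k)) * r m
      ≤ r m₀ + α * Real.log s.card := by
  set D := ∑ k ∈ s, Real.exp (-(1 / α) * r k) with hD
  have hD₀ : Real.exp (-(1 / α) * r m₀) ≤ D :=
    Finset.single_le_sum (f := fun k => Real.exp (-(1 / α) * r k))
      (fun _ _ => (Real.exp_pos _).le) hm₀
  have hDpos : 0 < D := (Real.exp_pos _).trans_le hD₀
  set w : M → ℝ := fun m => Real.exp (-(1 / α) * r m) / D with hw
  have hw0 : ∀ m ∈ s, 0 ≤ w m := fun m _ => by positivity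
  have hw1 : ∑ m ∈ s, w m = 1 := by
    rw [hw, ← Finset.sum_div, ← hD, div_self hDpos.ne']
  -- Jensen for `exp`: after multiplication by its weight, each exponential becomes `exp(-r m₀ / α)
  -- / D ≤ 1`, so the weighted sum is at most the number of models.
  have hj := convexOn_exp.map_sum_le hw0 hw1 (p := fun m => (r m - r m₀) / α)
    (fun _ _ => Set.mem_univ _)
  simp only [smul_eq_mul] at hj
  have hb : ∑ m ∈ s, w m * Real.exp ((r m - r m₀) / α) ≤ s.card := by
    have : ∀ m ∈ s, w m * Real.exp ((r m - r m₀) / α) ≤ 1 := by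
      intro m _
      rw [hw]
      simp only
      rw [div_mul_eq_mul_div, ← Real.exp_add, div_le_one hDpos]
      refine le_trans (le_of_eq ?_) hD₀
      congr 1; ring
    simpa using Finset.sum_le_card_nsmul s _ 1 this
  have h2 : ∑ m ∈ s, w m * ((r m - r m₀) / α) ≤ Real.log s.card := by
    rw [Real.le_log_iff_exp_le (by exact_mod_cast Finset.card_pos.2 ⟨m₀, hm₀⟩)]
    exact hj.trans hb
  have h3 : ∑ m ∈ s, w m * ((r m - r m₀) / α) = (∑ m ∈ s, w m * r m - r m₀) / α := by
    rw [sub_div, Finset.sum_div]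
    have : r m₀ / α = ∑ m ∈ s, w m * (r m₀ / α) := by rw [← Finset.sum_mul, hw1, one_mul]
    rw [this, ← Finset.sum_sub_distrib]
    exact Finset.sum_congr rfl fun _ _ => by ring
  rw [h3, div_le_iff₀ hα] at h2
  linarith

/-- The noise vector `ξ` has small inner products with all deviations of the fits from the
transformed mean. -/
def NoiseControlled {n p : ℕ} {κ : Type*} [Fintype κ] (R : Matrix κ (Fin n) ℝ)
    (X : Matrix (Fin n) (Fin p) ℝ) (μ : Fin n → ℝ) (u : ℕ) (G : ℝ) (ξ : κ → ℝ) : Prop :=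
  ∀ m ∈ models p u, ∀ c : Fin p → ℝ, (∀ j, j ∉ m → c j = 0) →
    (ξ ⬝ᵥ (R *ᵥ μ - (R * X) *ᵥ c)) ^ 2 ≤ G * sqNorm (R *ᵥ μ - (R * X) *ᵥ c)

/-- Arithmetic–geometric mean inequality, weighted so that a cross term uses up only half of the
squared deviation `s`. -/
theorem two_mul_abs_le_of_sq_le {t G s : ℝ} (hG : 0 ≤ G) (hs : 0 ≤ s) (h : t ^ 2 ≤ G * s) :
    2 * |t| ≤ s / 2 + 2 * G := by
  rw [← abs_two, ← abs_mul]
  refine abs_le_of_sq_le_sq ?_ (by positivity)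
  nlinarith [sq_nonneg (s / 2 - 2 * G)]

theorem leastSquares_spec {ι : Type*} [Fintype ι] {p : ℕ} (X : Matrix ι (Fin p) ℝ)
    (m : Finset (Fin p)) (y : ι → ℝ) : IsLeastSquares X m y (leastSquares X m y) :=
  Classical.choose_spec (exists_isLeastSquares X m y)

section Aggregation

variable {n p a b : ℕ}

/-- Accuracy of the residual sums of squares after exponential weighting. -/
theorem abs_sqNorm_residual_sub_le (A : Matrix (Fin a) (Fin n) ℝ) (B : Matrix (Fin b) (Fin n) ℝ)
    (X : Matrix (Fin n) (Fin p) ℝ) (μ Y : Fin n → ℝ) (ξA : Fin a → ℝ) (ξB : Fin b → ℝ)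
    {α : ℝ} (hα : 0 < α) {u : ℕ} {G κ : ℝ} (hG : 0 ≤ G)
    (hYA : A *ᵥ Y = A *ᵥ μ + ξA) (hYB : B *ᵥ Y = B *ᵥ μ + ξB)
    (hA : NoiseControlled A X μ u G ξA) (hB : NoiseControlled B X μ u G ξB)
    {m₀ : Finset (Fin p)} (hm₀ : m₀ ∈ models p u) {c₀ : Fin p → ℝ} (hc₀ : ∀ j, j ∉ m₀ → c₀ j = 0)
    (hκ : sqNorm (A *ᵥ μ - (A * X) *ᵥ c₀) + sqNorm (B *ᵥ μ - (B * X) *ᵥ c₀) ≤ κ) :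
    let β := betaEW (stackQ A B * X) α u (stackQ A B *ᵥ Y)
    let ρ := 5 * κ + 26 * G + 3 * (α * Real.log (models p u).card)
    |sqNorm (A *ᵥ Y - (A * X) *ᵥ β) - sqNorm ξA| ≤ ρ ∧
      |sqNorm (B *ᵥ Y - (B * X) *ᵥ β) - sqNorm ξB| ≤ ρ := by
  intro β ρ
  set y := stackQ A B *ᵥ Y with hy
  set X' := stackQ A B * X with hX'
  let bh : Finset (Fin p) → Fin p → ℝ := fun m => leastSquares X' m y
  let rA : (Fin p → ℝ) → Fin a → ℝ := fun c => A *ᵥ μ - (A * X) *ᵥ c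
  let rB : (Fin p → ℝ) → Fin b → ℝ := fun c => B *ᵥ μ - (B * X) *ᵥ c
  have hres : ∀ c, sqNorm (y - X' *ᵥ c) = sqNorm (ξA + rA c) + sqNorm (ξB + rB c) := by
    intro c
    rw [← sqNorm_sumElim]
    congr 1
    rw [hy, hX', stackQ, fromRows_mul, fromRows_mulVec, fromRows_mulVec, hYA, hYB]
    ext (i | i) <;> simp [rA, rB] <;> ring
  have hcrossA : ∀ m ∈ models p u, ∀ c, (∀ j, j ∉ m → c j = 0) →
      2 * |ξA ⬝ᵥ rA c| ≤ sqNorm (rA c) / 2 + 2 * G := fun m hm c hc =>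
    two_mul_abs_le_of_sq_le hG (sqNorm_nonneg _) (hA m hm c hc)
  have hcrossB : ∀ m ∈ models p u, ∀ c, (∀ j, j ∉ m → c j = 0) →
      2 * |ξB ⬝ᵥ rB c| ≤ sqNorm (rB c) / 2 + 2 * G := fun m hm c hc =>
    two_mul_abs_le_of_sq_le hG (sqNorm_nonneg _) (hB m hm c hc)
  let w : Finset (Fin p) → ℝ := expWeight X' α u y
  have hsumpos :
      0 < ∑ k ∈ models p u, Real.exp (-(1 / α) * sqNorm (y - X' *ᵥ leastSquares X' k y)) :=
    Finset.sum_pos (fun _ _ => Real.exp_pos _) ⟨m₀, hm₀⟩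
  have hw0 : ∀ m ∈ models p u, 0 ≤ w m := fun m _ => div_nonneg (Real.exp_pos _).le hsumpos.le
  have hw1 : ∑ m ∈ models p u, w m = 1 := by
    simp only [w, expWeight]
    rw [← Finset.sum_div, div_self hsumpos.ne']
  have hgibbs := sum_expWeights_mul_le (models p u)
    (fun m => sqNorm (y - X' *ᵥ leastSquares X' m y)) hα hm₀
  have hls := (leastSquares_spec X' m₀ y).2 c₀ hc₀
  have hup : sqNorm (y - X' *ᵥ c₀) ≤ sqNorm ξA + sqNorm ξB + 3 / 2 * κ + 4 * G := by
    rw [hres, sqNorm_add, sqNorm_add]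
    have h1 := hcrossA m₀ hm₀ c₀ hc₀
    have h2 := hcrossB m₀ hm₀ c₀ hc₀
    have h3 := le_abs_self (ξA ⬝ᵥ rA c₀)
    have h4 := le_abs_self (ξB ⬝ᵥ rB c₀)
    change sqNorm (rA c₀) + sqNorm (rB c₀) ≤ κ at hκ
    linarith
  have hlow : ∀ m ∈ models p u, sqNorm ξA + sqNorm ξB
      + (sqNorm (rA (bh m)) + sqNorm (rB (bh m))) / 2 - 4 * G ≤ sqNorm (y - X' *ᵥ bh m) := by
    intro m hm
    have hs := (leastSquares_spec X' m y).1
    rw [hres, sqNorm_add, sqNorm_add]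
    have h1 := hcrossA m hm (bh m) hs
    have h2 := hcrossB m hm (bh m) hs
    have h3 := neg_abs_le (ξA ⬝ᵥ rA (bh m))
    have h4 := neg_abs_le (ξB ⬝ᵥ rB (bh m))
    linarith
  set T := ∑ m ∈ models p u, w m * (sqNorm (rA (bh m)) + sqNorm (rB (bh m))) with hT
  -- Averaging `hlow` bounds the weighted loss from below by noise plus `T/2 - 4G`; the Gibbs
  -- inequality and the comparator `c₀` bound it from above by noise plus `3κ/2 + 4G + α log |M_u|`.
  -- The noise terms cancel.
  have hTle : T ≤ 3 * κ + 16 * G + 2 * (α * Real.log (models p u).card) := by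
    have h1 : sqNorm ξA + sqNorm ξB + T / 2 - 4 * G
        ≤ ∑ m ∈ models p u, w m * sqNorm (y - X' *ᵥ bh m) := by
      have h2 : sqNorm ξA + sqNorm ξB + T / 2 - 4 * G = ∑ m ∈ models p u, w m *
          (sqNorm ξA + sqNorm ξB + (sqNorm (rA (bh m)) + sqNorm (rB (bh m))) / 2 - 4 * G) := by
        have h3 : sqNorm ξA + sqNorm ξB - 4 * G
            = ∑ m ∈ models p u, w m * (sqNorm ξA + sqNorm ξB - 4 * G) := by
          rw [← Finset.sum_mul, hw1, one_mul]
        rw [show sqNorm ξA + sqNorm ξB + T / 2 - 4 * G = (sqNorm ξA + sqNorm ξB - 4 * G) + T / 2 by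
          ring, h3, hT, Finset.sum_div, ← Finset.sum_add_distrib]
        exact Finset.sum_congr rfl fun _ _ => by ring
      rw [h2]
      exact Finset.sum_le_sum fun m hm => mul_le_mul_of_nonneg_left (hlow m hm) (hw0 m hm)
    have h4 : ∑ m ∈ models p u, w m * sqNorm (y - X' *ᵥ bh m)
        ≤ sqNorm (y - X' *ᵥ leastSquares X' m₀ y) + α * Real.log (models p u).card := hgibbs
    linarith
  have hβ : ∀ (k : ℕ) (R : Matrix (Fin k) (Fin n) ℝ), R *ᵥ μ - (R * X) *ᵥ β
      = ∑ m ∈ models p u, w m • (R *ᵥ μ - (R * X) *ᵥ bh m) := by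
    intro k R
    have h1 : (R * X) *ᵥ β = ∑ m ∈ models p u, w m • ((R * X) *ᵥ bh m) := by
      simp only [β, betaEW]
      rw [mulVec_sum]
      exact Finset.sum_congr rfl fun m _ => mulVec_smul _ _ _
    simp only [smul_sub, Finset.sum_sub_distrib]
    rw [← Finset.sum_smul, hw1, one_smul, h1]
  have hfin : ∀ (k : ℕ) (R : Matrix (Fin k) (Fin n) ℝ) (ξ : Fin k → ℝ), R *ᵥ Y = R *ᵥ μ + ξ →
      (∀ m ∈ models p u, 2 * |ξ ⬝ᵥ (R *ᵥ μ - (R * X) *ᵥ bh m)|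
        ≤ sqNorm (R *ᵥ μ - (R * X) *ᵥ bh m) / 2 + 2 * G) →
      (∑ m ∈ models p u, w m * sqNorm (R *ᵥ μ - (R * X) *ᵥ bh m) ≤ T) →
      |sqNorm (R *ᵥ Y - (R * X) *ᵥ β) - sqNorm ξ| ≤ 3 / 2 * T + 2 * G := by
    intro k R ξ hY hcr hle
    rw [hY, show R *ᵥ μ + ξ - (R * X) *ᵥ β = ξ + (R *ᵥ μ - (R * X) *ᵥ β) by abel, sqNorm_add,
      hβ k R]
    have h1 := sqNorm_sum_smul_le (models p u) w hw0 hw1 (fun m => R *ᵥ μ - (R * X) *ᵥ bh m)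
    -- The aggregate need not be supported on one `u`-model, so noise control does not apply to it
    -- directly; it is applied to each fit and averaged.
    have h2 : 2 * |ξ ⬝ᵥ ∑ m ∈ models p u, w m • (R *ᵥ μ - (R * X) *ᵥ bh m)| ≤ T / 2 + 2 * G := by
      rw [dotProduct_sum]
      calc 2 * |∑ m ∈ models p u, ξ ⬝ᵥ w m • (R *ᵥ μ - (R * X) *ᵥ bh m)|
          ≤ 2 * ∑ m ∈ models p u, |ξ ⬝ᵥ w m • (R *ᵥ μ - (R * X) *ᵥ bh m)| := by
            gcongr; exact Finset.abs_sum_le_sum_abs _ _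
        _ = ∑ m ∈ models p u, w m * (2 * |ξ ⬝ᵥ (R *ᵥ μ - (R * X) *ᵥ bh m)|) := by
            rw [Finset.mul_sum]
            refine Finset.sum_congr rfl fun m hm => ?_
            rw [dotProduct_smul, smul_eq_mul, abs_mul, abs_of_nonneg (hw0 m hm)]
            ring
        _ ≤ ∑ m ∈ models p u, w m * (sqNorm (R *ᵥ μ - (R * X) *ᵥ bh m) / 2 + 2 * G) :=
            Finset.sum_le_sum fun m hm => mul_le_mul_of_nonneg_left (hcr m hm) (hw0 m hm)
        _ = (∑ m ∈ models p u, w m * sqNorm (R *ᵥ μ - (R * X) *ᵥ bh m)) / 2 + 2 * G := by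
            simp only [mul_add, Finset.sum_add_distrib]
            rw [← Finset.sum_mul, hw1, Finset.sum_div]
            congr 1
            · exact Finset.sum_congr rfl fun _ _ => by ring
            · ring
        _ ≤ _ := by gcongr
    have h3 := sqNorm_nonneg (∑ m ∈ models p u, w m • (R *ᵥ μ - (R * X) *ᵥ bh m))
    rw [abs_le] at *
    have h4 := abs_le.1 (show |ξ ⬝ᵥ ∑ m ∈ models p u, w m • (R *ᵥ μ - (R * X) *ᵥ bh m)|
      ≤ (T / 2 + 2 * G) / 2 by linarith)
    constructor <;> linarith [h4.1, h4.2]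
  have hκ0 : 0 ≤ κ := le_trans (add_nonneg (sqNorm_nonneg _) (sqNorm_nonneg _)) hκ
  have hρ : 3 / 2 * T + 2 * G ≤ ρ := by simp only [ρ]; linarith
  constructor
  · refine (hfin a A ξA hYA (fun m hm => hcrossA m hm _ (leastSquares_spec X' m y).1) ?_).trans hρ
    exact Finset.sum_le_sum fun m hm => mul_le_mul_of_nonneg_left
      (le_add_of_nonneg_right (sqNorm_nonneg _)) (hw0 m hm)
  · refine (hfin b B ξB hYB (fun m hm => hcrossB m hm _ (leastSquares_spec X' m y).1) ?_).trans hρ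
    exact Finset.sum_le_sum fun m hm => mul_le_mul_of_nonneg_left
      (le_add_of_nonneg_left (sqNorm_nonneg _)) (hw0 m hm)

end Aggregation

-- Contrast matrices and sparse approximation of the mean

section Design

theorem stackQ_mul_transpose {a b n : ℕ} {A : Matrix (Fin a) (Fin n) ℝ}
    {B : Matrix (Fin b) (Fin n) ℝ} (hA : A * Aᵀ = 1) (hB : B * Bᵀ = 1) (hAB : A * Bᵀ = 0) :
    stackQ A B * (stackQ A B)ᵀ = 1 := by
  have hBA : B * Aᵀ = 0 := by
    have := congrArg transpose hAB
    simpa using this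
  rw [stackQ, transpose_fromRows, fromRows_mul_fromCols, hA, hB, hAB, hBA, fromBlocks_one]

/-- Bessel's inequality: `0 ≤ ‖v - QᵀQ v‖² = ‖v‖² - ‖Q v‖²`. -/
theorem sqNorm_mulVec_le {κ : Type*} [Fintype κ] [DecidableEq κ] {n : ℕ}
    {Q : Matrix κ (Fin n) ℝ} (hQ : Q * Qᵀ = 1) (v : Fin n → ℝ) : sqNorm (Q *ᵥ v) ≤ sqNorm v := by
  have h := sqNorm_nonneg (v + (-1 : ℝ) • (Qᵀ *ᵥ (Q *ᵥ v)))
  rw [sqNorm_add, sqNorm_smul, dotProduct_smul, dotProduct_mulVec, vecMul_transpose,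
    ← sqNorm_eq_dotProduct, sqNorm_eq_dotProduct (Qᵀ *ᵥ _), dotProduct_mulVec, vecMul_transpose,
    mulVec_mulVec, hQ, one_mulVec, ← sqNorm_eq_dotProduct, smul_eq_mul] at h
  linarith

theorem stackQ_mulVec {a b n : ℕ} (A : Matrix (Fin a) (Fin n) ℝ) (B : Matrix (Fin b) (Fin n) ℝ)
    (v : Fin n → ℝ) : stackQ A B *ᵥ v = Sum.elim (A *ᵥ v) (B *ᵥ v) :=
  fromRows_mulVec _ _ _

theorem exists_sqNorm_sub_mulVec_le_perpSq {ι : Type*} [Fintype ι] {p : ℕ}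
    (X : Matrix ι (Fin p) ℝ) (m : Finset (Fin p)) (y : ι → ℝ) :
    ∃ c : Fin p → ℝ, (∀ j, j ∉ m → c j = 0) ∧ sqNorm (y - X *ᵥ c) ≤ perpSq X m y := by
  classical
  have hproj := (colSpan X m).starProjection_apply_mem (WithLp.toLp 2 y)
  obtain ⟨b, hb⟩ := (Submodule.mem_span_image_finset_iff_exists_fun ℝ).1 hproj
  refine ⟨fun j => if hj : j ∈ m then b ⟨j, hj⟩ else 0, fun j hj => by simp [hj], le_of_eq ?_⟩
  rw [sqNorm_eq_norm_sq, perpSq, Submodule.starProjection_orthogonal_val, WithLp.toLp_sub, ← hb]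
  congr 3
  ext i
  simp only [mulVec, dotProduct, WithLp.ofLp_sum, WithLp.ofLp_smul, Finset.sum_apply,
    Pi.smul_apply, smul_eq_mul]
  rw [← Finset.sum_subset (Finset.subset_univ m) (fun j _ hj => by simp [hj]),
    ← Finset.sum_coe_sort m]
  exact Finset.sum_congr rfl fun j _ => by simp [mul_comm]

/-- The sparse model is enlarged to exactly `u` covariates with zero coefficients on the added ones,
which is possible because `s ≤ u ≤ p`; applying `Q` does not increase the error. -/
theorem exists_model_approx {n p a b s u : ℕ} {A : Matrix (Fin a) (Fin n) ℝ}
    {B : Matrix (Fin b) (Fin n) ℝ} (hA : A * Aᵀ = 1) (hB : B * Bᵀ = 1) (hAB : A * Bᵀ = 0)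
    {X : Matrix (Fin n) (Fin p) ℝ} {μ : Fin n → ℝ} {κ : ℝ} (hsu : s ≤ u) (hup : u ≤ p)
    (h : ∃ m ∈ models p s, perpSq X m μ ≤ κ) :
    ∃ m₀ ∈ models p u, ∃ c₀ : Fin p → ℝ, (∀ j, j ∉ m₀ → c₀ j = 0) ∧
      sqNorm (A *ᵥ μ - (A * X) *ᵥ c₀) + sqNorm (B *ᵥ μ - (B * X) *ᵥ c₀) ≤ κ := by
  obtain ⟨m, hm, hκ⟩ := h
  obtain ⟨c, hc, hle⟩ := exists_sqNorm_sub_mulVec_le_perpSq X m μ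
  have hcard : m.card = s := (Finset.mem_powersetCard.1 hm).2
  obtain ⟨m₀, hsub, hm₀⟩ := Finset.exists_superset_card_eq (s := m) (n := u) (by omega) (by simpa)
  refine ⟨m₀, Finset.mem_powersetCard.2 ⟨Finset.subset_univ _, hm₀⟩, c,
    fun j hj => hc j fun h => hj (hsub h), ?_⟩
  have h1 := sqNorm_mulVec_le (stackQ_mul_transpose hA hB hAB) (μ - X *ᵥ c)
  rw [stackQ_mulVec, sqNorm_sumElim, mulVec_sub, mulVec_sub, mulVec_mulVec, mulVec_mulVec] at h1
  linarith

end Design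

/-! ### Probability of the control event for a fixed design -/

/-- Union bound over models. For fixed `m` all deviations lie in the span of `Rμ` and the `u`
columns of `RX` in `m`; the additional dimension for `Rμ` gives `u + 1`. -/
theorem noiseLaw_not_noiseControlled_le {n v p : ℕ} {κ : Type*} [Fintype κ] [DecidableEq κ]
    {R : Matrix κ (Fin n) ℝ} (hR : R * Rᵀ = 1) (Z : Matrix (Fin n) (Fin v) ℝ)
    (X : Matrix (Fin n) (Fin p) ℝ) (μ : Fin n → ℝ) (u : ℕ)
    {Ψ : Matrix (Fin v) (Fin v) ℝ} {σsq : ℝ} (hΨ : Ψ.PosSemidef) (hσ : 0 ≤ σsq)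
    {lam G : ℝ} (hlam : 0 < lam) (hG : 0 ≤ G)
    (hS : ∀ w, w ⬝ᵥ noiseCov R Z Ψ σsq *ᵥ w ≤ lam * sqNorm w) :
    (noiseLaw Ψ σsq).real {x | ¬ NoiseControlled R X μ u G (noiseVec R Z x)}
      ≤ (models p u).card * Real.exp ((u + 1) / 2 - G / (4 * lam)) := by
  classical
  let K : Finset (Fin p) → Submodule ℝ (κ → ℝ) := fun m =>
    Submodule.span ℝ ((insert (R *ᵥ μ) (m.image fun j i => (R * X) i j) : Finset (κ → ℝ)) :
      Set (κ → ℝ))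
  have hsub : {x | ¬ NoiseControlled R X μ u G (noiseVec R Z x)} ⊆ ⋃ m ∈ models p u,
      {x | ∃ w ∈ K m, G * sqNorm w < (noiseVec R Z x ⬝ᵥ w) ^ 2} := by
    intro x hx
    simp only [Set.mem_ofPred_eq, NoiseControlled, not_forall, not_le] at hx
    obtain ⟨m, hm, c, hc, hlt⟩ := hx
    refine Set.mem_biUnion hm ⟨_, ?_, hlt⟩
    refine Submodule.sub_mem _ (Submodule.subset_span (by simp)) ?_
    have h1 : (R * X) *ᵥ c = ∑ j ∈ m, c j • (fun i => (R * X) i j) := by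
      ext i
      simp only [mulVec, dotProduct, Finset.sum_apply, Pi.smul_apply, smul_eq_mul]
      rw [← Finset.sum_subset (Finset.subset_univ m) (fun j _ hj => by simp [hc j hj])]
      exact Finset.sum_congr rfl fun j _ => mul_comm _ _
    rw [h1]
    refine Submodule.sum_mem _ fun j hj => Submodule.smul_mem _ _ (Submodule.subset_span ?_)
    simp only [Finset.coe_insert, Finset.coe_image, Set.mem_insert_iff, Set.mem_image,
      Finset.mem_coe]
    exact Or.inr ⟨j, hj, rfl⟩
  refine (measureReal_mono hsub (measure_ne_top _ _)).trans
    ((measureReal_biUnion_finset_le _ _).trans ?_)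
  rw [← nsmul_eq_mul]
  refine Finset.sum_le_card_nsmul _ _ _ fun m hm => ?_
  have hcard : m.card = u := (Finset.mem_powersetCard.1 hm).2
  have hd : Module.finrank ℝ (K m) ≤ u + 1 := by
    refine (finrank_span_finset_le_card _).trans ((Finset.card_insert_le _ _).trans ?_)
    have := Finset.card_image_le (s := m) (f := fun j i => (R * X) i j)
    omega
  have := noiseLaw_subspace_tail hR Z hΨ hσ (K m) hd hlam hG hS
  push_cast at this
  exact this

/-! ### Measurability of the control event -/

theorem measurable_matrix_apply {Ω ι κ : Type*} [MeasurableSpace Ω] {M : Ω → Matrix ι κ ℝ}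
    (hM : Measurable M) (i : ι) (j : κ) : Measurable fun ω => M ω i j :=
  measurable_pi_iff.1 (measurable_pi_iff.1 hM i) j

theorem measurable_matrix_mulVec {Ω ι κ : Type*} [MeasurableSpace Ω] [Fintype κ]
    {M : Ω → Matrix ι κ ℝ} (hM : Measurable M) {x : Ω → κ → ℝ} (hx : Measurable x) :
    Measurable fun ω => M ω *ᵥ x ω := by
  refine measurable_pi_iff.2 fun i => ?_
  simp only [mulVec, dotProduct]
  exact Finset.measurable_sum _ fun j _ =>
    (measurable_matrix_apply hM i j).mul (measurable_pi_iff.1 hx j)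

/-- The condition is closed in `c` and rational vectors are dense. The control event thus becomes a
countable intersection, measurable jointly in design and noise. -/
theorem noiseControlled_iff_rat {n p : ℕ} {κ : Type*} [Fintype κ] (R : Matrix κ (Fin n) ℝ)
    (X : Matrix (Fin n) (Fin p) ℝ) (μ : Fin n → ℝ) (u : ℕ) (G : ℝ) (ξ : κ → ℝ) :
    NoiseControlled R X μ u G ξ ↔ ∀ m ∈ models p u, ∀ c : Fin p → ℚ,
      (ξ ⬝ᵥ (R *ᵥ (μ - X *ᵥ fun j => if j ∈ m then (c j : ℝ) else 0))) ^ 2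
        ≤ G * sqNorm (R *ᵥ (μ - X *ᵥ fun j => if j ∈ m then (c j : ℝ) else 0)) := by
  constructor
  · intro h m hm c
    rw [mulVec_sub, mulVec_mulVec]
    exact h m hm _ fun j hj => by simp [hj]
  · intro h m hm c hc
    have hd : DenseRange fun (c : Fin p → ℚ) (j : Fin p) => (c j : ℝ) :=
      DenseRange.piMap fun _ => Rat.denseRange_cast
    have key : ∀ d : Fin p → ℝ, (ξ ⬝ᵥ (R *ᵥ (μ - X *ᵥ fun j => if j ∈ m then d j else 0))) ^ 2
        ≤ G * sqNorm (R *ᵥ (μ - X *ᵥ fun j => if j ∈ m then d j else 0)) := by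
      intro d
      refine hd.induction_on d ?_ (h m hm)
      have hc1 : Continuous fun d : Fin p → ℝ =>
          R *ᵥ (μ - X *ᵥ fun j => if j ∈ m then d j else 0) := by
        have h0 : Continuous fun (d : Fin p → ℝ) j => if j ∈ m then d j else 0 := by
          refine continuous_pi fun j => ?_
          split_ifs <;> fun_prop
        exact continuous_const.matrix_mulVec
          (continuous_const.sub (continuous_const.matrix_mulVec h0))
      exact isClosed_le ((continuous_const.dotProduct hc1).pow 2)
        (continuous_const.mul (continuous_sqNorm.comp hc1))
    have := key c
    have hcc : (fun j => if j ∈ m then c j else 0) = c := by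
      ext j; by_cases hj : j ∈ m <;> simp [hj, hc]
    rwa [hcc, mulVec_sub, mulVec_mulVec] at this

theorem measurableSet_noiseControlled {Ω : Type*} [MeasurableSpace Ω] {n p : ℕ} {κ : Type*}
    [Fintype κ] {R : Ω → Matrix κ (Fin n) ℝ} (hR : Measurable R)
    {X : Ω → Matrix (Fin n) (Fin p) ℝ} (hX : Measurable X) {μ : Ω → Fin n → ℝ} (hμ : Measurable μ)
    (u : ℕ) (G : ℝ) {ξ : Ω → κ → ℝ} (hξ : Measurable ξ) :
    MeasurableSet {ω | NoiseControlled (R ω) (X ω) (μ ω) u G (ξ ω)} := by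
  have : {ω | NoiseControlled (R ω) (X ω) (μ ω) u G (ξ ω)}
      = ⋂ m ∈ models p u, ⋂ c : Fin p → ℚ, {ω |
      (ξ ω ⬝ᵥ (R ω *ᵥ (μ ω - X ω *ᵥ fun j => if j ∈ m then (c j : ℝ) else 0))) ^ 2
        ≤ G * sqNorm (R ω *ᵥ (μ ω - X ω *ᵥ fun j => if j ∈ m then (c j : ℝ) else 0))} := by
    ext ω
    simp only [Set.mem_ofPred_eq, Set.mem_iInter]
    exact noiseControlled_iff_rat _ _ _ _ _ _
  rw [this]
  refine Finset.measurableSet_biInter _ fun m _ => MeasurableSet.iInter fun c => ?_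
  have h1 : Measurable fun ω => R ω *ᵥ (μ ω - X ω *ᵥ fun j => if j ∈ m then (c j : ℝ) else 0) :=
    measurable_matrix_mulVec hR (hμ.sub (measurable_matrix_mulVec hX measurable_const))
  refine measurableSet_le (Measurable.pow_const ?_ 2)
    (measurable_const.mul (measurable_sqNorm.comp h1))
  simp only [dotProduct]
  exact Finset.measurable_sum _ fun i _ =>
    (measurable_pi_iff.1 hξ i).mul (measurable_pi_iff.1 h1 i)

/-! ### Eigenvalue bounds for quadratic forms -/

section Spectrum

variable {κ : Type*} [Fintype κ] [DecidableEq κ] {M : Matrix κ κ ℝ}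

theorem smul_one_quadForm (c : ℝ) (w : κ → ℝ) :
    w ⬝ᵥ (c • (1 : Matrix κ κ ℝ)) *ᵥ w = c * sqNorm w := by
  rw [smul_mulVec, one_mulVec, dotProduct_smul, smul_eq_mul, sqNorm_eq_dotProduct]

open scoped MatrixOrder in
-- A bound on the spectrum of a Hermitian matrix is a bound in the Loewner order, by the functional
-- calculus; the spectrum is finite, so its supremum is a genuine bound.
theorem quadForm_le_lamMax (hM : M.IsHermitian) (w : κ → ℝ) :
    w ⬝ᵥ M *ᵥ w ≤ lamMax M * sqNorm w := by
  have h := le_algebraMap_of_spectrum_le (R := ℝ) (a := M) (r := lamMax M)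
    (fun x hx => le_csSup M.finite_real_spectrum.bddAbove hx) hM
  rw [Matrix.le_iff, Algebra.algebraMap_eq_smul_one] at h
  have h2 := h.dotProduct_mulVec_nonneg w
  rw [star_trivial, sub_mulVec, dotProduct_sub, smul_one_quadForm] at h2
  linarith

open scoped MatrixOrder in
theorem lamMin_le_quadForm (hM : M.IsHermitian) (w : κ → ℝ) :
    lamMin M * sqNorm w ≤ w ⬝ᵥ M *ᵥ w := by
  have h := algebraMap_le_of_le_spectrum (R := ℝ) (a := M) (r := lamMin M)
    (fun x hx => csInf_le M.finite_real_spectrum.bddBelow hx) hM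
  rw [Matrix.le_iff, Algebra.algebraMap_eq_smul_one] at h
  have h2 := h.dotProduct_mulVec_nonneg w
  rw [star_trivial, sub_mulVec, dotProduct_sub, smul_one_quadForm] at h2
  linarith

theorem eq_zero_of_lamMax_eq_zero (hM : M.PosSemidef) (h : lamMax M = 0) : M = 0 := by
  refine hM.1.eigenvalues_eq_zero_iff.1 (funext fun i => le_antisymm ?_ (hM.eigenvalues_nonneg i))
  refine le_trans (le_csSup M.finite_real_spectrum.bddAbove ?_) h.le
  rw [hM.1.spectrum_real_eq_range_eigenvalues]
  exact ⟨i, rfl⟩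

end Spectrum

-- Covariance of the transformed noise

section NoiseCov

variable {n v a b : ℕ} {κ : Type*} [Fintype κ] [DecidableEq κ]

theorem noiseCov_quadForm (R : Matrix κ (Fin n) ℝ) (Z : Matrix (Fin n) (Fin v) ℝ)
    (Ψ : Matrix (Fin v) (Fin v) ℝ) (σsq : ℝ) (w : κ → ℝ) :
    w ⬝ᵥ noiseCov R Z Ψ σsq *ᵥ w
      = (Zᵀ *ᵥ (Rᵀ *ᵥ w)) ⬝ᵥ Ψ *ᵥ (Zᵀ *ᵥ (Rᵀ *ᵥ w)) + σsq * sqNorm w := by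
  rw [noiseCov, add_mulVec, dotProduct_add, smul_one_quadForm]
  congr 1
  rw [show R * Z * Ψ * Zᵀ * Rᵀ = (R * Z) * (Ψ * (Zᵀ * Rᵀ)) by simp [Matrix.mul_assoc],
    ← mulVec_mulVec, dotProduct_mulVec, ← mulVec_transpose, transpose_mul, ← mulVec_mulVec,
    ← mulVec_mulVec, ← mulVec_mulVec]

/-- Padding by zeros lets eigenvalue bounds for the covariance of the full vector `Q(Zν + ε)` pass
to its `A` block. -/
theorem quadForm_noiseCov_stackQ_inl (A : Matrix (Fin a) (Fin n) ℝ) (B : Matrix (Fin b) (Fin n) ℝ)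
    (Z : Matrix (Fin n) (Fin v) ℝ) (Ψ : Matrix (Fin v) (Fin v) ℝ) (σsq : ℝ) (w : Fin a → ℝ) :
    w ⬝ᵥ noiseCov A Z Ψ σsq *ᵥ w
      = Sum.elim w 0 ⬝ᵥ noiseCov (stackQ A B) Z Ψ σsq *ᵥ Sum.elim w 0 := by
  have h : (stackQ A B)ᵀ *ᵥ Sum.elim w 0 = Aᵀ *ᵥ w := by
    rw [stackQ, transpose_fromRows, fromCols_mulVec_sumElim]
    simp
  rw [noiseCov_quadForm, noiseCov_quadForm, h, sqNorm_sumElim]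
  simp [sqNorm]

theorem noiseCov_eq_of_mul_eq_zero {κ : Type*} [DecidableEq κ] {R : Matrix κ (Fin n) ℝ}
    {Z : Matrix (Fin n) (Fin v) ℝ} (h : R * Z = 0) (Ψ : Matrix (Fin v) (Fin v) ℝ) (σsq : ℝ) :
    noiseCov R Z Ψ σsq = σsq • 1 := by
  simp [noiseCov, h]

/-- `B * Z = 0` kills every block of the signal covariance except the `A` block, which vanishes
under the null hypothesis. The noise is then isotropic. -/
theorem noiseCov_stackQ_eq {A : Matrix (Fin a) (Fin n) ℝ} {B : Matrix (Fin b) (Fin n) ℝ}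
    {Z : Matrix (Fin n) (Fin v) ℝ} {Ψ : Matrix (Fin v) (Fin v) ℝ}
    (hA : A * Z * Ψ * Zᵀ * Aᵀ = 0) (hB : B * Z = 0) (σsq : ℝ) :
    noiseCov (stackQ A B) Z Ψ σsq = σsq • 1 := by
  have hB' : Zᵀ * Bᵀ = 0 := by
    have := congrArg transpose hB
    simpa using this
  have h : stackQ A B * Z * Ψ * Zᵀ * (stackQ A B)ᵀ = 0 := by
    rw [stackQ, fromRows_mul, fromRows_mul, fromRows_mul, transpose_fromRows,
      fromRows_mul_fromCols, hA, hB]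
    simp only [Matrix.zero_mul]
    rw [Matrix.mul_assoc _ Zᵀ Bᵀ, hB', Matrix.mul_zero, fromBlocks_zero]
  rw [noiseCov, h, zero_add]

theorem noiseVec_stackQ (A : Matrix (Fin a) (Fin n) ℝ) (B : Matrix (Fin b) (Fin n) ℝ)
    (Z : Matrix (Fin n) (Fin v) ℝ) (x : EuclideanSpace ℝ (Fin v) × EuclideanSpace ℝ (Fin n)) :
    noiseVec (stackQ A B) Z x = Sum.elim (noiseVec A Z x) (noiseVec B Z x) :=
  stackQ_mulVec A B _

/-! ### Quadratic forms of the noise for a fixed design -/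

/-- With a symmetric root `L` of the covariance `S`, `‖L z‖² = zᵀ S z ≥ τ‖z‖²`, so the event is
contained in a lower-tail event of a chi-square variable. -/
theorem noiseLaw_sqNorm_lower {R : Matrix κ (Fin n) ℝ} [Nonempty κ] (hR : R * Rᵀ = 1)
    (Z : Matrix (Fin n) (Fin v) ℝ)
    {Ψ : Matrix (Fin v) (Fin v) ℝ} {σsq : ℝ} (hΨ : Ψ.PosSemidef) (hσ : 0 ≤ σsq) {τ : ℝ}
    (hτ : 0 < τ) (hS : ∀ w, τ * sqNorm w ≤ w ⬝ᵥ noiseCov R Z Ψ σsq *ᵥ w) (K : ℝ) :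
    (noiseLaw Ψ σsq).real {x | sqNorm (noiseVec R Z x)
      ≤ τ * (Fintype.card κ - K * √(Fintype.card κ))} ≤ Real.exp (1 / 4 - K / 4) := by
  obtain ⟨L, hL, hLT⟩ := exists_mul_transpose_eq (posSemidef_noiseCov R Z hΨ hσ)
  have hms : MeasurableSet {y : κ → ℝ | sqNorm y ≤ τ * (Fintype.card κ - K * √(Fintype.card κ))} :=
    measurableSet_le measurable_sqNorm measurable_const
  have h1 := map_measureReal_apply (μ := noiseLaw Ψ σsq) (measurable_noiseVec R Z) hms
  rw [noiseLaw_map_noiseVec hR Z hΨ hσ hL, map_measureReal_apply (by fun_prop) hms] at h1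
  refine h1.symm.trans_le ((measureReal_mono ?_).trans (stdPi_lower_tail (ι := κ) K))
  intro z hz
  simp only [Set.mem_preimage, Set.mem_ofPred_eq] at hz ⊢
  have h2 : sqNorm (L *ᵥ z) = z ⬝ᵥ noiseCov R Z Ψ σsq *ᵥ z := by
    rw [← hL, hLT, ← mulVec_mulVec, dotProduct_mulVec z, ← mulVec_transpose, hLT,
      sqNorm_eq_dotProduct]
  have h3 := hS z
  rw [← h2] at h3
  exact le_of_mul_le_mul_left (h3.trans hz) hτ

theorem noiseLaw_sqNorm_upper {R : Matrix κ (Fin n) ℝ} [Nonempty κ] (hR : R * Rᵀ = 1)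
    (Z : Matrix (Fin n) (Fin v) ℝ)
    {Ψ : Matrix (Fin v) (Fin v) ℝ} {σsq : ℝ} (hΨ : Ψ.PosSemidef) (hσ : 0 ≤ σsq) {τ : ℝ}
    (hτ : 0 < τ) (hS : ∀ w, w ⬝ᵥ noiseCov R Z Ψ σsq *ᵥ w ≤ τ * sqNorm w) (K : ℝ) :
    (noiseLaw Ψ σsq).real {x | τ * (Fintype.card κ + K * √(Fintype.card κ))
      ≤ sqNorm (noiseVec R Z x)} ≤ Real.exp (1 / 4 - K / 4) := by
  obtain ⟨L, hL, hLT⟩ := exists_mul_transpose_eq (posSemidef_noiseCov R Z hΨ hσ)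
  have hms : MeasurableSet {y : κ → ℝ | τ * (Fintype.card κ + K * √(Fintype.card κ)) ≤ sqNorm y} :=
    measurableSet_le measurable_const measurable_sqNorm
  have h1 := map_measureReal_apply (μ := noiseLaw Ψ σsq) (measurable_noiseVec R Z) hms
  rw [noiseLaw_map_noiseVec hR Z hΨ hσ hL, map_measureReal_apply (by fun_prop) hms] at h1
  refine h1.symm.trans_le ((measureReal_mono ?_).trans (stdPi_upper_tail (ι := κ) K))
  intro z hz
  simp only [Set.mem_preimage, Set.mem_ofPred_eq] at hz ⊢
  have h2 : sqNorm (L *ᵥ z) = z ⬝ᵥ noiseCov R Z Ψ σsq *ᵥ z := by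
    rw [← hL, hLT, ← mulVec_mulVec, dotProduct_mulVec z, ← mulVec_transpose, hLT,
      sqNorm_eq_dotProduct]
  have h3 := hS z
  rw [← h2] at h3
  exact le_of_mul_le_mul_left (hz.trans h3) hτ

/-- If the noise is isotropic, then the ratio of its mean squares has the `F` distribution. -/
theorem noiseLaw_ratio_real {A : Matrix (Fin a) (Fin n) ℝ} {B : Matrix (Fin b) (Fin n) ℝ}
    (hQ : stackQ A B * (stackQ A B)ᵀ = 1) (Z : Matrix (Fin n) (Fin v) ℝ)
    {Ψ : Matrix (Fin v) (Fin v) ℝ} {σsq : ℝ} (hΨ : Ψ.PosSemidef) (hσ : 0 < σsq)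
    (hS : noiseCov (stackQ A B) Z Ψ σsq = σsq • 1) (x : ℝ) :
    (noiseLaw Ψ σsq).real {y | x < (sqNorm (noiseVec A Z y) / a) / (sqNorm (noiseVec B Z y) / b)}
      = (fDist a b).real (Set.Ioi x) := by
  have hL : (√σsq • (1 : Matrix (Fin a ⊕ Fin b) (Fin a ⊕ Fin b) ℝ))
      * (√σsq • (1 : Matrix (Fin a ⊕ Fin b) (Fin a ⊕ Fin b) ℝ))ᵀ
      = noiseCov (stackQ A B) Z Ψ σsq := by
    rw [hS]
    simp [smul_smul, Real.mul_self_sqrt hσ.le]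
  have hmr : Measurable fun y : Fin a ⊕ Fin b → ℝ =>
      (sqNorm (fun i => y (Sum.inl i)) / a) / (sqNorm (fun i => y (Sum.inr i)) / b) := by
    have h1 : Measurable fun (y : Fin a ⊕ Fin b → ℝ) i => y (Sum.inl i) := by fun_prop
    have h2 : Measurable fun (y : Fin a ⊕ Fin b → ℝ) i => y (Sum.inr i) := by fun_prop
    exact ((measurable_sqNorm.comp h1).div_const _).div ((measurable_sqNorm.comp h2).div_const _)
  have hms : MeasurableSet {y : Fin a ⊕ Fin b → ℝ | x <
      (sqNorm (fun i => y (Sum.inl i)) / a) / (sqNorm (fun i => y (Sum.inr i)) / b)} :=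
    measurableSet_lt measurable_const hmr
  have h1 := map_measureReal_apply (μ := noiseLaw Ψ σsq) (measurable_noiseVec (stackQ A B) Z) hms
  rw [noiseLaw_map_noiseVec hQ Z hΨ hσ.le hL, map_measureReal_apply (by fun_prop) hms] at h1
  have h2 : (noiseVec (stackQ A B) Z) ⁻¹' {y : Fin a ⊕ Fin b → ℝ | x <
      (sqNorm (fun i => y (Sum.inl i)) / a) / (sqNorm (fun i => y (Sum.inr i)) / b)}
      = {y | x < (sqNorm (noiseVec A Z y) / a) / (sqNorm (noiseVec B Z y) / b)} := by
    ext y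
    simp [noiseVec_stackQ]
  rw [h2] at h1
  rw [← h1, fDist_real_Ioi]
  have h3 := measurePreserving_sumPiEquivProdPi (X := fun _ : Fin a ⊕ Fin b => ℝ)
    (fun _ => gaussianReal 0 1)
  have hms' : MeasurableSet {z : (Fin a → ℝ) × (Fin b → ℝ) |
      x < (sqNorm z.1 / a) / (sqNorm z.2 / b)} :=
    measurableSet_lt measurable_const (measurable_fRatio a b)
  rw [← h3.map_eq, map_measureReal_apply h3.measurable hms']
  congr 1
  ext z
  have h4 : (√σsq • (1 : Matrix (Fin a ⊕ Fin b) (Fin a ⊕ Fin b) ℝ)) *ᵥ z = √σsq • z := by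
    rw [smul_mulVec, one_mulVec]
  simp only [Set.mem_preimage, Set.mem_ofPred_eq, h4, Pi.smul_apply]
  have h5 : ∀ (k : ℕ) (y : Fin k → ℝ), sqNorm (fun i => √σsq • y i) = σsq * sqNorm y := by
    intro k y
    have := sqNorm_smul (√σsq) y
    rw [Real.sq_sqrt hσ.le] at this
    exact this
  rw [h5 a (fun i => z (Sum.inl i)), h5 b (fun i => z (Sum.inr i)), mul_div_assoc σsq _ (a : ℝ),
    mul_div_assoc σsq _ (b : ℝ), mul_div_mul_left _ _ hσ.ne']
  rfl

end NoiseCov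

-- From fixed to random designs

/-- The space of designs `(μ, X, Z, W, A, B)`. -/
abbrev DesignSpace (n p v r a b : ℕ) : Type :=
  (Fin n → ℝ) × Matrix (Fin n) (Fin p) ℝ × Matrix (Fin n) (Fin v) ℝ × Matrix (Fin n) (Fin r) ℝ ×
    Matrix (Fin a) (Fin n) ℝ × Matrix (Fin b) (Fin n) ℝ

/-- Neither set has to be measurable. Events involving the test statistic, which is built from
chosen least-squares coefficients, are only ever compared by inclusion and subadditivity, so its
measurability is never at issue. -/
theorem measureReal_mono_ae {Ω : Type*} [MeasurableSpace Ω] {P : Measure Ω} [IsFiniteMeasure P]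
    {S T : Set Ω} (h : ∀ᵐ ω ∂P, ω ∈ S → ω ∈ T) : P.real S ≤ P.real T :=
  ENNReal.toReal_mono (measure_ne_top _ _) (measure_mono_ae h)

namespace IsMixedModel

variable {Ω : Type*} [MeasurableSpace Ω] {P : Measure Ω} {n p v r a b : ℕ}
  {μ : Ω → Fin n → ℝ} {X : Ω → Matrix (Fin n) (Fin p) ℝ} {Z : Ω → Matrix (Fin n) (Fin v) ℝ}
  {W : Ω → Matrix (Fin n) (Fin r) ℝ} {A : Ω → Matrix (Fin a) (Fin n) ℝ}
  {B : Ω → Matrix (Fin b) (Fin n) ℝ} {ν : Ω → EuclideanSpace ℝ (Fin v)} {γ : Ω → Fin r → ℝ}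
  {ε : Ω → EuclideanSpace ℝ (Fin n)} {Ψ : Matrix (Fin v) (Fin v) ℝ} {σsq : ℝ}

/-- By independence the joint law of design and noise is a product, so one may condition on the
design and use the fixed-design estimates, almost surely, with nonrandom bounds. -/
theorem measure_eq_lintegral (hM : IsMixedModel P μ X Z W A B ν γ ε Ψ σsq)
    {S : Set (DesignSpace n p v r a b × (EuclideanSpace ℝ (Fin v) × EuclideanSpace ℝ (Fin n)))}
    (hS : MeasurableSet S) :
    P {ω | ((μ ω, X ω, Z ω, W ω, A ω, B ω), (ν ω, ε ω)) ∈ S}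
      = ∫⁻ ω, noiseLaw Ψ σsq {x | ((μ ω, X ω, Z ω, W ω, A ω, B ω), x) ∈ S} ∂P := by
  have := hM.isProbabilityMeasure
  have hD := hM.measurable_design
  have hN : Measurable fun ω => (ν ω, ε ω) := hM.measurable_nu.prodMk hM.measurable_eps
  have hlaw : P.map (fun ω => (ν ω, ε ω)) = noiseLaw Ψ σsq := by
    rw [(indepFun_iff_map_prod_eq_prod_map_map hM.measurable_nu.aemeasurable
      hM.measurable_eps.aemeasurable).1 hM.indep_nu_eps, hM.law_nu, hM.law_eps]
  have hprod := (indepFun_iff_map_prod_eq_prod_map_map hD.aemeasurable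
    hN.aemeasurable).1 hM.indep_design
  have h1 := Measure.map_apply (μ := P) (hD.prodMk hN) hS
  rw [hprod, hlaw, Measure.prod_apply hS,
    lintegral_map (measurable_measure_prodMk_left hS) hD] at h1
  exact h1.symm

theorem real_le (hM : IsMixedModel P μ X Z W A B ν γ ε Ψ σsq)
    {S : Set (DesignSpace n p v r a b × (EuclideanSpace ℝ (Fin v) × EuclideanSpace ℝ (Fin n)))}
    (hS : MeasurableSet S) {η : ℝ} (hη : 0 ≤ η)
    (h : ∀ᵐ ω ∂P, (noiseLaw Ψ σsq).real {x | ((μ ω, X ω, Z ω, W ω, A ω, B ω), x) ∈ S} ≤ η) :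
    P.real {ω | ((μ ω, X ω, Z ω, W ω, A ω, B ω), (ν ω, ε ω)) ∈ S} ≤ η := by
  have := hM.isProbabilityMeasure
  refine ENNReal.toReal_le_of_le_ofReal hη ?_
  rw [hM.measure_eq_lintegral hS]
  refine (lintegral_mono_ae (g := fun _ => ENNReal.ofReal η) ?_).trans (by simp)
  filter_upwards [h] with ω hω
  rw [← ofReal_measureReal]
  exact ENNReal.ofReal_le_ofReal hω

theorem real_eq (hM : IsMixedModel P μ X Z W A B ν γ ε Ψ σsq)
    {S : Set (DesignSpace n p v r a b × (EuclideanSpace ℝ (Fin v) × EuclideanSpace ℝ (Fin n)))}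
    (hS : MeasurableSet S) {η : ℝ}
    (h : ∀ᵐ ω ∂P, (noiseLaw Ψ σsq).real {x | ((μ ω, X ω, Z ω, W ω, A ω, B ω), x) ∈ S} = η) :
    P.real {ω | ((μ ω, X ω, Z ω, W ω, A ω, B ω), (ν ω, ε ω)) ∈ S} = η := by
  have := hM.isProbabilityMeasure
  have hη : 0 ≤ η := by
    obtain ⟨ω, hω⟩ := h.exists
    exact hω ▸ measureReal_nonneg
  rw [Measure.real, hM.measure_eq_lintegral hS,
    lintegral_congr_ae (g := fun _ => ENNReal.ofReal η)]
  · simp [hη]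
  filter_upwards [h] with ω hω
  rw [← hω, ofReal_measureReal]

theorem measurable_designNoiseVec {κ : Type*} {R : DesignSpace n p v r a b → Matrix κ (Fin n) ℝ}
    (hR : Measurable R) : Measurable fun q : DesignSpace n p v r a b ×
      (EuclideanSpace ℝ (Fin v) × EuclideanSpace ℝ (Fin n)) =>
        noiseVec (R q.1) q.1.2.2.1 q.2 := by
  unfold noiseVec
  refine measurable_matrix_mulVec (hR.comp measurable_fst) ?_
  have h1 : Measurable fun q : DesignSpace n p v r a b ×
      (EuclideanSpace ℝ (Fin v) × EuclideanSpace ℝ (Fin n)) => q.2.1.ofLp := by fun_prop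
  have h2 : Measurable fun q : DesignSpace n p v r a b ×
      (EuclideanSpace ℝ (Fin v) × EuclideanSpace ℝ (Fin n)) => q.2.2.ofLp := by fun_prop
  exact (measurable_matrix_mulVec (by fun_prop) h1).add h2

section

variable {κ : Type*} [Fintype κ] [DecidableEq κ] {R : DesignSpace n p v r a b → Matrix κ (Fin n) ℝ}

theorem real_not_noiseControlled_le (hM : IsMixedModel P μ X Z W A B ν γ ε Ψ σsq) (hσ : 0 ≤ σsq)
    (hRm : Measurable R)
    (hR : ∀ᵐ ω ∂P, R (μ ω, X ω, Z ω, W ω, A ω, B ω) * (R (μ ω, X ω, Z ω, W ω, A ω, B ω))ᵀ = 1)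
    {lam G : ℝ} (hlam : 0 < lam) (hG : 0 ≤ G)
    (hS : ∀ᵐ ω ∂P, ∀ w, w ⬝ᵥ noiseCov (R (μ ω, X ω, Z ω, W ω, A ω, B ω)) (Z ω) Ψ σsq *ᵥ w
      ≤ lam * sqNorm w) (u : ℕ) :
    P.real {ω | ¬ NoiseControlled (R (μ ω, X ω, Z ω, W ω, A ω, B ω)) (X ω) (μ ω) u G
      (noiseVec (R (μ ω, X ω, Z ω, W ω, A ω, B ω)) (Z ω) (ν ω, ε ω))}
      ≤ (models p u).card * Real.exp ((u + 1) / 2 - G / (4 * lam)) := by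
  refine hM.real_le (S := {q | ¬ NoiseControlled (R q.1) q.1.2.1 q.1.1 u G
    (noiseVec (R q.1) q.1.2.2.1 q.2)}) ?_ (by positivity) ?_
  · exact (measurableSet_noiseControlled (hRm.comp measurable_fst) (by fun_prop) (by fun_prop) u G
      (measurable_designNoiseVec hRm)).compl
  · filter_upwards [hR, hS] with ω h1 h2
    exact noiseLaw_not_noiseControlled_le h1 (Z ω) (X ω) (μ ω) u hM.posSemidef hσ hlam hG h2

theorem real_sqNorm_lower (hM : IsMixedModel P μ X Z W A B ν γ ε Ψ σsq) (hσ : 0 ≤ σsq)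
    [Nonempty κ] (hRm : Measurable R)
    (hR : ∀ᵐ ω ∂P, R (μ ω, X ω, Z ω, W ω, A ω, B ω) * (R (μ ω, X ω, Z ω, W ω, A ω, B ω))ᵀ = 1)
    {τ : ℝ} (hτ : 0 < τ)
    (hS : ∀ᵐ ω ∂P, ∀ w, τ * sqNorm w
      ≤ w ⬝ᵥ noiseCov (R (μ ω, X ω, Z ω, W ω, A ω, B ω)) (Z ω) Ψ σsq *ᵥ w) (K : ℝ) :
    P.real {ω | sqNorm (noiseVec (R (μ ω, X ω, Z ω, W ω, A ω, B ω)) (Z ω) (ν ω, ε ω))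
      ≤ τ * (Fintype.card κ - K * √(Fintype.card κ))} ≤ Real.exp (1 / 4 - K / 4) := by
  refine hM.real_le (S := {q | sqNorm (noiseVec (R q.1) q.1.2.2.1 q.2)
    ≤ τ * (Fintype.card κ - K * √(Fintype.card κ))}) ?_ (by positivity) ?_
  · exact measurableSet_le (measurable_sqNorm.comp (measurable_designNoiseVec hRm)) measurable_const
  · filter_upwards [hR, hS] with ω h1 h2
    exact noiseLaw_sqNorm_lower h1 (Z ω) hM.posSemidef hσ hτ h2 K

theorem real_sqNorm_upper (hM : IsMixedModel P μ X Z W A B ν γ ε Ψ σsq) (hσ : 0 ≤ σsq)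
    [Nonempty κ] (hRm : Measurable R)
    (hR : ∀ᵐ ω ∂P, R (μ ω, X ω, Z ω, W ω, A ω, B ω) * (R (μ ω, X ω, Z ω, W ω, A ω, B ω))ᵀ = 1)
    {τ : ℝ} (hτ : 0 < τ)
    (hS : ∀ᵐ ω ∂P, ∀ w, w ⬝ᵥ noiseCov (R (μ ω, X ω, Z ω, W ω, A ω, B ω)) (Z ω) Ψ σsq *ᵥ w
      ≤ τ * sqNorm w) (K : ℝ) :
    P.real {ω | τ * (Fintype.card κ + K * √(Fintype.card κ))
      ≤ sqNorm (noiseVec (R (μ ω, X ω, Z ω, W ω, A ω, B ω)) (Z ω) (ν ω, ε ω))}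
      ≤ Real.exp (1 / 4 - K / 4) := by
  refine hM.real_le (S := {q | τ * (Fintype.card κ + K * √(Fintype.card κ))
    ≤ sqNorm (noiseVec (R q.1) q.1.2.2.1 q.2)}) ?_ (by positivity) ?_
  · exact measurableSet_le measurable_const (measurable_sqNorm.comp (measurable_designNoiseVec hRm))
  · filter_upwards [hR, hS] with ω h1 h2
    exact noiseLaw_sqNorm_upper h1 (Z ω) hM.posSemidef hσ hτ h2 K

end

theorem ae_noiseCov_B (hM : IsMixedModel P μ X Z W A B ν γ ε Ψ σsq) :
    ∀ᵐ ω ∂P, noiseCov (B ω) (Z ω) Ψ σsq = σsq • 1 := by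
  filter_upwards [hM.B_mul_Z] with ω h
  exact noiseCov_eq_of_mul_eq_zero h _ _

theorem le_quadForm_noiseCov_A (hM : IsMixedModel P μ X Z W A B ν γ ε Ψ σsq) (ω : Ω)
    (w : Fin a → ℝ) : σsq * sqNorm w ≤ w ⬝ᵥ noiseCov (A ω) (Z ω) Ψ σsq *ᵥ w := by
  rw [noiseCov_quadForm]
  have := hM.posSemidef.dotProduct_mulVec_nonneg ((Z ω)ᵀ *ᵥ ((A ω)ᵀ *ᵥ w))
  rw [star_trivial] at this
  linarith

/-- The ratio of the mean squares of the noise in the two sets of contrasts. -/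
theorem real_ratio_eq (hM : IsMixedModel P μ X Z W A B ν γ ε Ψ σsq) (hσ : 0 < σsq)
    (hA : ∀ᵐ ω ∂P, A ω * Z ω * Ψ * (Z ω)ᵀ * (A ω)ᵀ = 0) (x : ℝ) :
    P.real {ω | x < (sqNorm (noiseVec (A ω) (Z ω) (ν ω, ε ω)) / a)
      / (sqNorm (noiseVec (B ω) (Z ω) (ν ω, ε ω)) / b)} = (fDist a b).real (Set.Ioi x) := by
  refine hM.real_eq (S := {q | x < (sqNorm (noiseVec q.1.2.2.2.2.1 q.1.2.2.1 q.2) / a)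
    / (sqNorm (noiseVec q.1.2.2.2.2.2 q.1.2.2.1 q.2) / b)}) ?_ ?_
  · refine measurableSet_lt measurable_const (Measurable.div ?_ ?_)
    · exact (measurable_sqNorm.comp
        (measurable_designNoiseVec (R := fun D => D.2.2.2.2.1) (by fun_prop))).div_const _
    · exact (measurable_sqNorm.comp
        (measurable_designNoiseVec (R := fun D => D.2.2.2.2.2) (by fun_prop))).div_const _
  · filter_upwards [hA, hM.B_mul_Z, hM.orthonormal_A, hM.orthonormal_B, hM.orthogonal_A_B]
      with ω h1 h2 h3 h4 h5
    exact noiseLaw_ratio_real (stackQ_mul_transpose h3 h4 h5) (Z ω) hM.posSemidef hσ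
      (noiseCov_stackQ_eq h1 h2 σsq) x

/-- The nuisance effects disappear pointwise, so `γ` may depend on the noise in any way. -/
theorem mulVec_response {k : ℕ} {R : Matrix (Fin k) (Fin n) ℝ} {W' : Matrix (Fin n) (Fin r) ℝ}
    (h : R * W' = 0) (μ' : Fin n → ℝ) (Z' : Matrix (Fin n) (Fin v) ℝ)
    (ν' : EuclideanSpace ℝ (Fin v)) (γ' : Fin r → ℝ) (ε' : EuclideanSpace ℝ (Fin n)) :
    R *ᵥ response μ' Z' W' ν' γ' ε' = R *ᵥ μ' + noiseVec R Z' (ν', ε') := by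
  have h1 : R *ᵥ (W' *ᵥ γ') = 0 := by rw [mulVec_mulVec, h, zero_mulVec]
  simp only [response, noiseVec, mulVec_add, h1]
  abel

end IsMixedModel

-- Comparison of the statistic with the ratio of noise mean squares

/-- Both directions reduce to `1 + θ/4 ≤ (1 - θ/4)(1 + θ)`, whose slack is `θ(2 - θ)/4`; this is
where `θ ≤ 2` enters. -/
theorem ratio_le_ratio_mul {U V N M a b θ : ℝ} (ha : 0 < a) (hb : 0 < b)
    (hU : 0 ≤ U) (hV : 0 < V) (hθ : 0 ≤ θ) (hθ2 : θ ≤ 2)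
    (hN : |N - U| ≤ θ / 4 * U) (hM : |M - V| ≤ θ / 4 * V) :
    (U / a) / (V / b) ≤ (N / a) / (M / b) * (1 + θ) ∧
      (N / a) / (M / b) ≤ (U / a) / (V / b) * (1 + θ) := by
  obtain ⟨h1, h2⟩ := abs_le.1 hN
  obtain ⟨h3, h4⟩ := abs_le.1 hM
  have hM0 : 0 < M := by nlinarith
  have e : ∀ x y : ℝ, (x / a) / (y / b) = (b / a) * (x / y) := fun x y => by
    rw [div_div_div_eq]; ring
  have hba : 0 ≤ b / a := by positivity
  rw [e, e, mul_assoc, mul_assoc]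
  constructor
  · refine mul_le_mul_of_nonneg_left ?_ hba
    rw [div_mul_eq_mul_div, div_le_div_iff₀ hV hM0]
    have h5 : M ≤ (1 + θ / 4) * V := by linarith
    have h6 : (1 - θ / 4) * U ≤ N := by linarith
    calc U * M ≤ U * ((1 + θ / 4) * V) := by gcongr
      _ ≤ ((1 - θ / 4) * U) * (1 + θ) * V := by
        have : 0 ≤ U * V := by positivity
        nlinarith [mul_nonneg this (mul_nonneg hθ (sub_nonneg.2 hθ2))]
      _ ≤ N * (1 + θ) * V := by gcongr
  · refine mul_le_mul_of_nonneg_left ?_ hba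
    rw [div_mul_eq_mul_div, div_le_div_iff₀ hM0 hV]
    have h5 : (1 - θ / 4) * V ≤ M := by linarith
    have h6 : N ≤ (1 + θ / 4) * U := by linarith
    calc N * V ≤ ((1 + θ / 4) * U) * V := by gcongr
      _ ≤ U * (1 + θ) * ((1 - θ / 4) * V) := by
        have : 0 ≤ U * V := by positivity
        nlinarith [mul_nonneg this (mul_nonneg hθ (sub_nonneg.2 hθ2))]
      _ ≤ U * (1 + θ) * M := by gcongr

namespace IsMixedModel

variable {Ω : Type*} [MeasurableSpace Ω] {P : Measure Ω} {n p v r a b : ℕ}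
  {μ : Ω → Fin n → ℝ} {X : Ω → Matrix (Fin n) (Fin p) ℝ} {Z : Ω → Matrix (Fin n) (Fin v) ℝ}
  {W : Ω → Matrix (Fin n) (Fin r) ℝ} {A : Ω → Matrix (Fin a) (Fin n) ℝ}
  {B : Ω → Matrix (Fin b) (Fin n) ℝ} {ν : Ω → EuclideanSpace ℝ (Fin v)} {γ : Ω → Fin r → ℝ}
  {ε : Ω → EuclideanSpace ℝ (Fin n)} {Ψ : Matrix (Fin v) (Fin v) ℝ} {σsq : ℝ}

/-- The statistic `F_EW` is close to the ratio of the mean squares of the noise, with an explicit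
bound on the probability of the exceptional event. -/
theorem real_not_close_le (hM : IsMixedModel P μ X Z W A B ν γ ε Ψ σsq) (hσ : 0 < σsq)
    (ha : 0 < a) (hb : 0 < b) {s u : ℕ} (hsu : s ≤ u) (hup : u ≤ p) {α κ lam G θ : ℝ} (hα : 0 < α)
    (hlam : σsq ≤ lam) (hG : 0 ≤ G) (hθ : 0 ≤ θ) (hθ2 : θ ≤ 2)
    (hκ : ∀ᵐ ω ∂P, ∃ m ∈ models p s, perpSq (X ω) m (μ ω) ≤ κ)
    (hA : ∀ᵐ ω ∂P, ∀ w, w ⬝ᵥ noiseCov (A ω) (Z ω) Ψ σsq *ᵥ w ≤ lam * sqNorm w)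
    (hρa : 5 * κ + 26 * G + 3 * (α * Real.log (models p u).card) ≤ θ * σsq * a / 8)
    (hρb : 5 * κ + 26 * G + 3 * (α * Real.log (models p u).card) ≤ θ * σsq * b / 8) :
    P.real {ω | ¬ ((sqNorm (noiseVec (A ω) (Z ω) (ν ω, ε ω)) / a)
          / (sqNorm (noiseVec (B ω) (Z ω) (ν ω, ε ω)) / b)
        ≤ fEW (A ω) (B ω) (X ω) α u (response (μ ω) (Z ω) (W ω) (ν ω) (γ ω) (ε ω)) * (1 + θ) ∧
      fEW (A ω) (B ω) (X ω) α u (response (μ ω) (Z ω) (W ω) (ν ω) (γ ω) (ε ω))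
        ≤ (sqNorm (noiseVec (A ω) (Z ω) (ν ω, ε ω)) / a)
          / (sqNorm (noiseVec (B ω) (Z ω) (ν ω, ε ω)) / b) * (1 + θ))}
      ≤ 2 * ((models p u).card * Real.exp ((u + 1) / 2 - G / (4 * lam)))
        + (Real.exp (1 / 4 - √a / 8) + Real.exp (1 / 4 - √b / 8)) := by
  have := hM.isProbabilityMeasure
  have : Nonempty (Fin a) := ⟨⟨0, ha⟩⟩
  have : Nonempty (Fin b) := ⟨⟨0, hb⟩⟩
  have hBle : ∀ᵐ ω ∂P, ∀ w, w ⬝ᵥ noiseCov (B ω) (Z ω) Ψ σsq *ᵥ w ≤ lam * sqNorm w := by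
    filter_upwards [hM.ae_noiseCov_B] with ω h w
    rw [h, smul_one_quadForm]
    exact mul_le_mul_of_nonneg_right hlam (sqNorm_nonneg w)
  have hBge : ∀ᵐ ω ∂P, ∀ w, σsq * sqNorm w ≤ w ⬝ᵥ noiseCov (B ω) (Z ω) Ψ σsq *ᵥ w := by
    filter_upwards [hM.ae_noiseCov_B] with ω h w
    rw [h, smul_one_quadForm]
  have e1 := hM.real_not_noiseControlled_le hσ.le (R := fun D => D.2.2.2.2.1) (by fun_prop)
    hM.orthonormal_A (hσ.trans_le hlam) hG hA u
  have e2 := hM.real_not_noiseControlled_le hσ.le (R := fun D => D.2.2.2.2.2) (by fun_prop)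
    hM.orthonormal_B (hσ.trans_le hlam) hG hBle u
  -- The deviation `K = √a / 2` puts the threshold at half the mean, `σsq * a / 2`. An absolute
  -- error `θ σsq a / 8` then becomes a relative error `θ / 4`.
  have e3 := hM.real_sqNorm_lower hσ.le (R := fun D => D.2.2.2.2.1) (by fun_prop)
    hM.orthonormal_A hσ (ae_of_all _ fun ω w => hM.le_quadForm_noiseCov_A ω w) (√a / 2)
  have e4 := hM.real_sqNorm_lower hσ.le (R := fun D => D.2.2.2.2.2) (by fun_prop)
    hM.orthonormal_B hσ hBge (√b / 2)
  have hhalf : ∀ k : ℕ, (k : ℝ) - √k / 2 * √k = k / 2 := fun k => by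
    have := Real.mul_self_sqrt (Nat.cast_nonneg (α := ℝ) k)
    linarith
  simp only [Fintype.card_fin, hhalf] at e1 e2 e3 e4
  set E1 := {ω | ¬ NoiseControlled (A ω) (X ω) (μ ω) u G (noiseVec (A ω) (Z ω) (ν ω, ε ω))} with hE1
  set E2 := {ω | ¬ NoiseControlled (B ω) (X ω) (μ ω) u G (noiseVec (B ω) (Z ω) (ν ω, ε ω))} with hE2
  set E3 := {ω | sqNorm (noiseVec (A ω) (Z ω) (ν ω, ε ω)) ≤ σsq * (a / 2)} with hE3
  set E4 := {ω | sqNorm (noiseVec (B ω) (Z ω) (ν ω, ε ω)) ≤ σsq * (b / 2)} with hE4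
  have hmono := measureReal_mono_ae (P := P) (T := (E1 ∪ E2) ∪ (E3 ∪ E4)) (S := _) (by
    filter_upwards [hκ, hM.orthonormal_A, hM.orthonormal_B, hM.orthogonal_A_B, hM.A_mul_W,
      hM.B_mul_W] with ω h1 h2 h3 h4 h5 h6
    intro (hω : ¬ ((sqNorm (noiseVec (A ω) (Z ω) (ν ω, ε ω)) / a)
          / (sqNorm (noiseVec (B ω) (Z ω) (ν ω, ε ω)) / b)
        ≤ fEW (A ω) (B ω) (X ω) α u (response (μ ω) (Z ω) (W ω) (ν ω) (γ ω) (ε ω)) * (1 + θ) ∧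
      fEW (A ω) (B ω) (X ω) α u (response (μ ω) (Z ω) (W ω) (ν ω) (γ ω) (ε ω))
        ≤ (sqNorm (noiseVec (A ω) (Z ω) (ν ω, ε ω)) / a)
          / (sqNorm (noiseVec (B ω) (Z ω) (ν ω, ε ω)) / b) * (1 + θ)))
    by_contra hcon
    simp only [hE1, hE2, hE3, hE4, Set.mem_union, Set.mem_ofPred_eq, not_or, not_not, not_le]
      at hcon
    obtain ⟨⟨g1, g2⟩, g3, g4⟩ := hcon
    obtain ⟨m₀, hm₀, c₀, hc₀, hle⟩ := exists_model_approx h2 h3 h4 hsu hup h1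
    have hres := abs_sqNorm_residual_sub_le (A ω) (B ω) (X ω) (μ ω)
      (response (μ ω) (Z ω) (W ω) (ν ω) (γ ω) (ε ω)) _ _ hα hG
      (mulVec_response h5 _ _ _ _ _) (mulVec_response h6 _ _ _ _ _) g1 g2 hm₀ hc₀ hle
    have ha' : (0 : ℝ) < a := by exact_mod_cast ha
    have hb' : (0 : ℝ) < b := by exact_mod_cast hb
    refine hω (ratio_le_ratio_mul ha' hb' (sqNorm_nonneg _) (lt_trans (by positivity) g4) hθ hθ2
      (hres.1.trans (hρa.trans ?_)) (hres.2.trans (hρb.trans ?_)))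
    · nlinarith [mul_le_mul_of_nonneg_left g3.le (show 0 ≤ θ / 4 by positivity)]
    · nlinarith [mul_le_mul_of_nonneg_left g4.le (show 0 ≤ θ / 4 by positivity)])
  refine hmono.trans ?_
  have u1 := measureReal_union_le (μ := P) (E1 ∪ E2) (E3 ∪ E4)
  have u2 := measureReal_union_le (μ := P) E1 E2
  have u3 := measureReal_union_le (μ := P) E3 E4
  rw [div_div] at e3 e4
  norm_num at e3 e4 ⊢
  linarith

end IsMixedModel

/-! ### Quantiles of the `F` distribution -/

section Quantile

variable {a b : ℕ} {δ : ℝ}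

theorem fRatio_nonneg (z : (Fin a → ℝ) × (Fin b → ℝ)) :
    0 ≤ (sqNorm z.1 / a) / (sqNorm z.2 / b) :=
  div_nonneg (div_nonneg (sqNorm_nonneg _) (Nat.cast_nonneg _))
    (div_nonneg (sqNorm_nonneg _) (Nat.cast_nonneg _))

theorem fDist_Ioi_of_neg {x : ℝ} (hx : x < 0) : (fDist a b).real (Set.Ioi x) = 1 := by
  rw [fDist_real_Ioi]
  have : {z : (Fin a → ℝ) × (Fin b → ℝ) | x < (sqNorm z.1 / a) / (sqNorm z.2 / b)} = Set.univ :=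
    Set.eq_univ_of_forall fun z => hx.trans_le (fRatio_nonneg z)
  rw [this, probReal_univ]

theorem bddBelow_fUpperQuantile_set (hδ₁ : δ < 1) :
    BddBelow {x : ℝ | (fDist a b).real (Set.Ioi x) ≤ δ} := by
  refine ⟨0, fun x hx => ?_⟩
  by_contra! h
  rw [Set.mem_ofPred_eq, fDist_Ioi_of_neg h] at hx
  linarith

theorem fUpperQuantile_le (hδ₁ : δ < 1) {x : ℝ} (h : (fDist a b).real (Set.Ioi x) ≤ δ) :
    fUpperQuantile a b δ ≤ x :=
  csInf_le (bddBelow_fUpperQuantile_set hδ₁) h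

theorem lt_fDist_Ioi_of_lt (hδ₁ : δ < 1) {x : ℝ} (h : x < fUpperQuantile a b δ) :
    δ < (fDist a b).real (Set.Ioi x) := by
  by_contra! hx
  exact absurd (fUpperQuantile_le hδ₁ hx) (not_le.2 h)

/-- The infimum is attained: `Ioi q` is the increasing union of the sets `Ioi (q + 1/(k+1))`, each
of mass at most `δ`. Vanishing tails make the defining set nonempty. -/
theorem fDist_Ioi_fUpperQuantile_le (hδ₀ : 0 < δ) :
    (fDist a b).real (Set.Ioi (fUpperQuantile a b δ)) ≤ δ := by
  set q := fUpperQuantile a b δ with hq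
  have hne : {x : ℝ | (fDist a b).real (Set.Ioi x) ≤ δ}.Nonempty := by
    have h1 : Tendsto (fun k : ℕ => (fDist a b).real (Set.Ioi (k : ℝ))) atTop (𝓝 0) := by
      have h2 := tendsto_measure_iInter_atTop (μ := fDist a b) (s := fun k : ℕ => Set.Ioi (k : ℝ))
        (fun k => measurableSet_Ioi.nullMeasurableSet)
        (fun i j hij => Set.Ioi_subset_Ioi (by exact_mod_cast hij)) ⟨0, measure_ne_top _ _⟩
      have h3 : ⋂ k : ℕ, Set.Ioi (k : ℝ) = ∅ := by
        refine Set.eq_empty_of_forall_notMem fun x hx => ?_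
        obtain ⟨k, hk⟩ := exists_nat_gt x
        exact absurd (Set.mem_iInter.1 hx k) (not_lt.2 hk.le)
      rw [h3, measure_empty] at h2
      exact (ENNReal.tendsto_toReal ENNReal.zero_ne_top).comp h2
    obtain ⟨k, hk⟩ := (h1.eventually_le_const hδ₀).exists
    exact ⟨k, hk⟩
  have hU : Set.Ioi q = ⋃ k : ℕ, Set.Ioi (q + 1 / (k + 1)) := by
    ext x
    simp only [Set.mem_Ioi, Set.mem_iUnion]
    constructor
    · intro hx
      obtain ⟨k, hk⟩ := exists_nat_one_div_lt (sub_pos.2 hx)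
      exact ⟨k, by linarith⟩
    · rintro ⟨k, hk⟩
      have : (0 : ℝ) < 1 / (k + 1) := by positivity
      linarith
  have h2 := tendsto_measure_iUnion_atTop (μ := fDist a b)
    (s := fun k : ℕ => Set.Ioi (q + 1 / ((k : ℝ) + 1)))
    (fun i j hij => Set.Ioi_subset_Ioi (by gcongr))
  rw [← hU] at h2
  have h3 : Tendsto (fun k : ℕ => (fDist a b).real (Set.Ioi (q + 1 / ((k : ℝ) + 1)))) atTop
      (𝓝 ((fDist a b).real (Set.Ioi q))) :=
    (ENNReal.tendsto_toReal (measure_ne_top _ _)).comp h2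
  refine le_of_tendsto h3 (Eventually.of_forall fun k => ?_)
  obtain ⟨x, hx, hlt⟩ := exists_lt_of_csInf_lt hne
    (show sInf _ < q + 1 / ((k : ℝ) + 1) from lt_add_of_pos_right q (by positivity))
  exact (measureReal_mono (Set.Ioi_subset_Ioi hlt.le)).trans hx

/-- The lower-tail bounds at `K = √a` and `K = √b` have threshold zero. Used to show that the
quantile is positive. -/
theorem fDist_Ioi_zero_ge (ha : 0 < a) (hb : 0 < b) :
    1 - (Real.exp (1 / 4 - √a / 4) + Real.exp (1 / 4 - √b / 4)) ≤ (fDist a b).real (Set.Ioi 0) := by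
  have : Nonempty (Fin a) := ⟨⟨0, ha⟩⟩
  have : Nonempty (Fin b) := ⟨⟨0, hb⟩⟩
  have ha' : (0 : ℝ) < a := by exact_mod_cast ha
  have hb' : (0 : ℝ) < b := by exact_mod_cast hb
  rw [fDist_real_Ioi]
  have h1 := stdPi_lower_tail (ι := Fin a) (√a)
  have h2 := stdPi_lower_tail (ι := Fin b) (√b)
  simp only [Fintype.card_fin, Real.mul_self_sqrt (Nat.cast_nonneg _), sub_self] at h1 h2
  have m1 : MeasurableSet {z : Fin a → ℝ | sqNorm z ≤ 0} :=
    measurableSet_le measurable_sqNorm measurable_const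
  have m2 : MeasurableSet {z : Fin b → ℝ | sqNorm z ≤ 0} :=
    measurableSet_le measurable_sqNorm measurable_const
  rw [← (measurePreserving_fst (μ := stdPi (Fin a)) (ν := stdPi (Fin b))).measureReal_preimage
    m1.nullMeasurableSet] at h1
  rw [← (measurePreserving_snd (μ := stdPi (Fin a)) (ν := stdPi (Fin b))).measureReal_preimage
    m2.nullMeasurableSet] at h2
  set S := {z : (Fin a → ℝ) × (Fin b → ℝ) | 0 < (sqNorm z.1 / a) / (sqNorm z.2 / b)} with hS
  have hcov : (Set.univ : Set ((Fin a → ℝ) × (Fin b → ℝ))) ⊆ S ∪ (Prod.fst ⁻¹' {z | sqNorm z ≤ 0}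
      ∪ Prod.snd ⁻¹' {z | sqNorm z ≤ 0}) := by
    intro z _
    by_contra hcon
    simp only [hS, Set.mem_union, Set.mem_preimage, Set.mem_ofPred_eq, not_or, not_le] at hcon
    obtain ⟨g1, g2, g3⟩ := hcon
    exact g1 (by positivity)
  have h3 := measureReal_mono (μ := (stdPi (Fin a)).prod (stdPi (Fin b))) hcov
  rw [probReal_univ] at h3
  have h4 := h3.trans (measureReal_union_le _ _)
  have h5 := measureReal_union_le (μ := (stdPi (Fin a)).prod (stdPi (Fin b)))
    (Prod.fst ⁻¹' {z | sqNorm z ≤ 0}) (Prod.snd ⁻¹' {z | sqNorm z ≤ 0})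
  linarith

/-- Off the two chi-square tails the numerator is at most `1 + K/√a` and the denominator at least `1
- K/√b`. This locates the upper quantile at most `O(n^(-1/2))` above one. -/
theorem fDist_Ioi_le (ha : 0 < a) (hb : 0 < b) {K : ℝ} (hK : 0 ≤ K) (hKb : K < √b) :
    (fDist a b).real (Set.Ioi ((1 + K / √a) / (1 - K / √b))) ≤ 2 * Real.exp (1 / 4 - K / 4) := by
  have : Nonempty (Fin a) := ⟨⟨0, ha⟩⟩
  have : Nonempty (Fin b) := ⟨⟨0, hb⟩⟩
  have ha' : (0 : ℝ) < a := by exact_mod_cast ha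
  have hb' : (0 : ℝ) < b := by exact_mod_cast hb
  rw [fDist_real_Ioi]
  have h1 := stdPi_upper_tail (ι := Fin a) K
  have h2 := stdPi_lower_tail (ι := Fin b) K
  simp only [Fintype.card_fin] at h1 h2
  have m1 : MeasurableSet {z : Fin a → ℝ | a + K * √a ≤ sqNorm z} :=
    measurableSet_le measurable_const measurable_sqNorm
  have m2 : MeasurableSet {z : Fin b → ℝ | sqNorm z ≤ b - K * √b} :=
    measurableSet_le measurable_sqNorm measurable_const
  rw [← (measurePreserving_fst (μ := stdPi (Fin a)) (ν := stdPi (Fin b))).measureReal_preimage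
    m1.nullMeasurableSet] at h1
  rw [← (measurePreserving_snd (μ := stdPi (Fin a)) (ν := stdPi (Fin b))).measureReal_preimage
    m2.nullMeasurableSet] at h2
  have hsa : 0 < √(a : ℝ) := Real.sqrt_pos.2 ha'
  have hsb : 0 < √(b : ℝ) := Real.sqrt_pos.2 hb'
  have hKb' : 0 < 1 - K / √b := by
    rw [sub_pos, div_lt_one hsb]; exact hKb
  have hcov : {z : (Fin a → ℝ) × (Fin b → ℝ) | (1 + K / √a) / (1 - K / √b)
      < (sqNorm z.1 / a) / (sqNorm z.2 / b)} ⊆ Prod.fst ⁻¹' {z | a + K * √a ≤ sqNorm z}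
      ∪ Prod.snd ⁻¹' {z | sqNorm z ≤ b - K * √b} := by
    intro z hz
    by_contra hcon
    simp only [Set.mem_union, Set.mem_preimage, Set.mem_ofPred_eq, not_or, not_le] at hcon hz
    obtain ⟨g1, g2⟩ := hcon
    refine hz.not_ge ?_
    have e1 : sqNorm z.1 / a ≤ 1 + K / √a := by
      rw [div_le_iff₀ ha']
      have : K / √a * a = K * √a := by
        rw [div_mul_eq_mul_div, mul_div_assoc, Real.div_sqrt]
      linarith
    have e2 : 1 - K / √b ≤ sqNorm z.2 / b := by
      rw [le_div_iff₀ hb']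
      have : K / √b * b = K * √b := by
        rw [div_mul_eq_mul_div, mul_div_assoc, Real.div_sqrt]
      linarith
    exact div_le_div₀ (by positivity) e1 hKb' e2
  have h3 := measureReal_mono (μ := (stdPi (Fin a)).prod (stdPi (Fin b))) hcov
  have h4 := h3.trans (measureReal_union_le _ _)
  linarith

end Quantile

/-! ### Error probabilities for a fixed sample size -/

namespace IsMixedModel

variable {Ω : Type*} [MeasurableSpace Ω] {P : Measure Ω} {n p v r a b : ℕ}
  {μ : Ω → Fin n → ℝ} {X : Ω → Matrix (Fin n) (Fin p) ℝ} {Z : Ω → Matrix (Fin n) (Fin v) ℝ}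
  {W : Ω → Matrix (Fin n) (Fin r) ℝ} {A : Ω → Matrix (Fin a) (Fin n) ℝ}
  {B : Ω → Matrix (Fin b) (Fin n) ℝ} {ν : Ω → EuclideanSpace ℝ (Fin v)} {γ : Ω → Fin r → ℝ}
  {ε : Ω → EuclideanSpace ℝ (Fin n)} {Ψ : Matrix (Fin v) (Fin v) ℝ} {σsq δ : ℝ}

/-- The type I error is close to the level. -/
theorem typeI_error_bounds (hM : IsMixedModel P μ X Z W A B ν γ ε Ψ σsq) (hσ : 0 < σsq)
    (hδ₀ : 0 < δ) (hδ₁ : δ < 1) (hA : ∀ᵐ ω ∂P, A ω * Z ω * Ψ * (Z ω)ᵀ * (A ω)ᵀ = 0)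
    (hq : 0 < fUpperQuantile a b δ) {θ η : ℝ} (hθ : 0 < θ) {f : Ω → ℝ}
    (hη : P.real {ω | ¬ ((sqNorm (noiseVec (A ω) (Z ω) (ν ω, ε ω)) / a)
          / (sqNorm (noiseVec (B ω) (Z ω) (ν ω, ε ω)) / b) ≤ f ω * (1 + θ) ∧
      f ω ≤ (sqNorm (noiseVec (A ω) (Z ω) (ν ω, ε ω)) / a)
          / (sqNorm (noiseVec (B ω) (Z ω) (ν ω, ε ω)) / b) * (1 + θ))} ≤ η) :
    P.real {ω | fUpperQuantile a b δ < f ω} ≤ δ + √(Real.exp (a * (θ ^ 2 / 2)) - 1) + η ∧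
      δ - 2 * √(Real.exp (a * (θ ^ 2 / 2)) - 1) - η
        ≤ P.real {ω | fUpperQuantile a b δ < f ω} := by
  have := hM.isProbabilityMeasure
  set q := fUpperQuantile a b δ with hqdef
  set F : Ω → ℝ := fun ω => (sqNorm (noiseVec (A ω) (Z ω) (ν ω, ε ω)) / a)
    / (sqNorm (noiseVec (B ω) (Z ω) (ν ω, ε ω)) / b) with hF
  set bad := {ω | ¬ (F ω ≤ f ω * (1 + θ) ∧ f ω ≤ F ω * (1 + θ))} with hbad
  have hlaw : ∀ x, P.real {ω | x < F ω} = (fDist a b).real (Set.Ioi x) := hM.real_ratio_eq hσ hA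
  have h1θ : 0 < 1 + θ := by linarith
  -- The comparison is made from `q / (1 + θ)` to `q` and from `q` to `q * (1 + θ)`. The tail
  -- exceeds `δ` strictly left of `q` and is at most `δ` at `q`, so no continuity of the `F`
  -- distribution is needed; the lower bound pays for both moves.
  have s1 := abs_le.1 (abs_fDist_scale_sub_le a b hθ.le (q / (1 + θ)))
  rw [div_mul_cancel₀ q h1θ.ne'] at s1
  have s2 := abs_le.1 (abs_fDist_scale_sub_le a b hθ.le q)
  have hqle : (fDist a b).real (Set.Ioi q) ≤ δ := fDist_Ioi_fUpperQuantile_le hδ₀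
  have hqlt : δ < (fDist a b).real (Set.Ioi (q / (1 + θ))) :=
    lt_fDist_Ioi_of_lt hδ₁ (div_lt_self hq (by linarith))
  have hη' : P.real bad ≤ η := hη
  constructor
  · have hsub : {ω | q < f ω} ⊆ {ω | q / (1 + θ) < F ω} ∪ bad := by
      intro ω hω
      by_cases hb : ω ∈ bad
      · exact Or.inr hb
      · left
        simp only [hbad, Set.mem_ofPred_eq, not_not] at hb hω ⊢
        rw [div_lt_iff₀ h1θ]
        exact hω.trans_le hb.2
    have := (measureReal_mono (μ := P) hsub).trans (measureReal_union_le _ _)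
    rw [hlaw] at this
    linarith [s1.1]
  · have hsub : {ω | q * (1 + θ) < F ω} ⊆ {ω | q < f ω} ∪ bad := by
      intro ω hω
      by_cases hb : ω ∈ bad
      · exact Or.inr hb
      · left
        simp only [hbad, Set.mem_ofPred_eq, not_not] at hb hω ⊢
        exact lt_of_mul_lt_mul_right (hω.trans_le hb.1) h1θ.le
    have := (measureReal_mono (μ := P) hsub).trans (measureReal_union_le _ _)
    rw [hlaw] at this
    linarith [s1.1, s2.1]

/-- The type II error is small if the signal exceeds the fluctuations. -/
theorem typeII_error_le (hM : IsMixedModel P μ X Z W A B ν γ ε Ψ σsq) (hσ : 0 < σsq)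
    (ha : 0 < a) (hb : 0 < b) {q θ η τ K : ℝ} (hθ : 0 < θ) (hτ : 0 < τ) {f : Ω → ℝ}
    (hA : ∀ᵐ ω ∂P, ∀ w, τ * sqNorm w ≤ w ⬝ᵥ noiseCov (A ω) (Z ω) Ψ σsq *ᵥ w)
    (hK : 0 ≤ K)
    (hq : q * (1 + θ) < (τ * (1 - K / √a)) / (σsq * (1 + K / √b)))
    (hη : P.real {ω | ¬ ((sqNorm (noiseVec (A ω) (Z ω) (ν ω, ε ω)) / a)
          / (sqNorm (noiseVec (B ω) (Z ω) (ν ω, ε ω)) / b) ≤ f ω * (1 + θ) ∧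
      f ω ≤ (sqNorm (noiseVec (A ω) (Z ω) (ν ω, ε ω)) / a)
          / (sqNorm (noiseVec (B ω) (Z ω) (ν ω, ε ω)) / b) * (1 + θ))} ≤ η) :
    P.real {ω | ¬ q < f ω} ≤ 2 * Real.exp (1 / 4 - K / 4) + Real.exp (1 / 4 - √b / 4) + η := by
  have := hM.isProbabilityMeasure
  have : Nonempty (Fin a) := ⟨⟨0, ha⟩⟩
  have : Nonempty (Fin b) := ⟨⟨0, hb⟩⟩
  have ha' : (0 : ℝ) < a := by exact_mod_cast ha
  have hb' : (0 : ℝ) < b := by exact_mod_cast hb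
  have hsa : 0 < √(a : ℝ) := Real.sqrt_pos.2 ha'
  have hsb : 0 < √(b : ℝ) := Real.sqrt_pos.2 hb'
  have hBle : ∀ᵐ ω ∂P, ∀ w, w ⬝ᵥ noiseCov (B ω) (Z ω) Ψ σsq *ᵥ w ≤ σsq * sqNorm w := by
    filter_upwards [hM.ae_noiseCov_B] with ω h w
    rw [h, smul_one_quadForm]
  have hBpos : ∀ᵐ ω ∂P, ∀ w, σsq * sqNorm w ≤ w ⬝ᵥ noiseCov (B ω) (Z ω) Ψ σsq *ᵥ w := by
    filter_upwards [hM.ae_noiseCov_B] with ω h w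
    rw [h, smul_one_quadForm]
  have e1 := hM.real_sqNorm_lower hσ.le (R := fun D => D.2.2.2.2.1) (by fun_prop)
    hM.orthonormal_A hτ hA K
  have e2 := hM.real_sqNorm_upper hσ.le (R := fun D => D.2.2.2.2.2) (by fun_prop)
    hM.orthonormal_B hσ hBle K
  -- With `K = √b` this excludes `V = 0`, where the convention `x / 0 = 0` would spoil the lower
  -- bound on the ratio.
  have e3 := hM.real_sqNorm_lower hσ.le (R := fun D => D.2.2.2.2.2) (by fun_prop)
    hM.orthonormal_B hσ hBpos (√b)
  simp only [Fintype.card_fin, Real.mul_self_sqrt (Nat.cast_nonneg _), sub_self, mul_zero]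
    at e1 e2 e3
  set U : Ω → ℝ := fun ω => sqNorm (noiseVec (A ω) (Z ω) (ν ω, ε ω)) with hU
  set V : Ω → ℝ := fun ω => sqNorm (noiseVec (B ω) (Z ω) (ν ω, ε ω)) with hV
  set bad := {ω | ¬ ((U ω / a) / (V ω / b) ≤ f ω * (1 + θ)
    ∧ f ω ≤ (U ω / a) / (V ω / b) * (1 + θ))} with hbad
  have hη' : P.real bad ≤ η := hη
  have hsub : {ω | ¬ q < f ω} ⊆ (({ω | U ω ≤ τ * (a - K * √a)}
      ∪ {ω | σsq * (b + K * √b) ≤ V ω}) ∪ {ω | V ω ≤ 0}) ∪ bad := by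
    intro ω hω
    by_contra hcon
    simp only [hbad, Set.mem_union, Set.mem_ofPred_eq, not_or, not_not, not_le] at hcon
    obtain ⟨⟨⟨g1, g2⟩, g3⟩, g4, -⟩ := hcon
    refine hω ?_
    have h1 : τ * (1 - K / √a) ≤ U ω / a := by
      rw [le_div_iff₀ ha']
      have : K / √a * a = K * √a := by rw [div_mul_eq_mul_div, mul_div_assoc, Real.div_sqrt]
      rw [mul_assoc, sub_mul, one_mul, this]
      exact g1.le
    have h2 : V ω / b ≤ σsq * (1 + K / √b) := by
      rw [div_le_iff₀ hb']
      have : K / √b * b = K * √b := by rw [div_mul_eq_mul_div, mul_div_assoc, Real.div_sqrt]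
      rw [mul_assoc, add_mul, one_mul, this]
      exact g2.le
    have h3 : (τ * (1 - K / √a)) / (σsq * (1 + K / √b)) ≤ (U ω / a) / (V ω / b) :=
      div_le_div₀ (div_nonneg (sqNorm_nonneg _) ha'.le) h1 (by positivity) h2
    exact lt_of_mul_lt_mul_right (hq.trans_le (h3.trans g4)) (by linarith)
  have h1 := (measureReal_mono (μ := P) hsub).trans (measureReal_union_le _ _)
  have h2 := measureReal_union_le (μ := P) ({ω | U ω ≤ τ * (a - K * √a)}
      ∪ {ω | σsq * (b + K * √b) ≤ V ω}) {ω | V ω ≤ 0}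
  have h3 := measureReal_union_le (μ := P) {ω | U ω ≤ τ * (a - K * √a)}
    {ω | σsq * (b + K * √b) ≤ V ω}
  linarith

end IsMixedModel

/-! ### Rates -/

theorem log_card_models_le {p u : ℕ} (h : u ≤ p) :
    Real.log (models p u).card ≤ u * Real.log p ∧ 0 ≤ Real.log (models p u).card := by
  have hcard : (models p u).card = p.choose u := by simp [models]
  have hpos : 0 < (models p u).card := hcard ▸ Nat.choose_pos h
  refine ⟨?_, Real.log_natCast_nonneg _⟩
  rw [← Real.log_pow]
  refine Real.log_le_log (by exact_mod_cast hpos) ?_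
  rw [hcard]
  exact_mod_cast Nat.choose_le_pow p u

/-- For `p ≥ 2` this is `log 2 ≤ log p`; for `p ≤ 1` the logarithm vanishes and the summand `1`
takes over. It turns `u log p = o(√n)` into `u = o(√n)`. -/
theorem natCast_le_of_le {p u : ℕ} (h : u ≤ p) :
    (u : ℝ) ≤ 1 + u * Real.log p / Real.log 2 := by
  have hl : 0 < Real.log 2 := Real.log_pos one_lt_two
  have h0 : 0 ≤ u * Real.log p / Real.log 2 :=
    div_nonneg (mul_nonneg (Nat.cast_nonneg _) (Real.log_natCast_nonneg _)) hl.le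
  by_cases hp : p ≤ 1
  · have : (u : ℝ) ≤ 1 := by exact_mod_cast h.trans hp
    linarith
  · have h2 : Real.log 2 ≤ Real.log p :=
      Real.log_le_log two_pos (by exact_mod_cast (not_le.1 hp))
    have : (u : ℝ) ≤ u * Real.log p / Real.log 2 := by
      rw [le_div_iff₀ hl]; gcongr
    linarith

theorem tendsto_sqrt_natCast_atTop : Tendsto (fun n : ℕ => √(n : ℝ)) atTop atTop :=
  Real.tendsto_sqrt_atTop.comp tendsto_natCast_atTop_atTop

/-- Rates for the control of the noise and for the relative error of the test statistic. -/
theorem exists_rates {c σsq lam : ℝ} (hc : 0 < c) (hσ : 0 < σsq) (hlam : 0 < lam)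
    {κ α : ℕ → ℝ} {p u : ℕ → ℕ} (hκ : κ =o[atTop] fun n : ℕ => √(n : ℝ))
    (hα : α =O[atTop] fun _ => (1 : ℝ)) (hup : ∀ᶠ n in atTop, u n ≤ p n)
    (hu : Tendsto (fun n => (u n : ℝ) * Real.log (p n) / √(n : ℝ)) atTop (𝓝 0)) :
    ∃ G θ : ℕ → ℝ, (∀ n, 0 ≤ G n) ∧ (∀ᶠ n in atTop, 0 < θ n) ∧
      Tendsto (fun n : ℕ => √(n : ℝ) * θ n) atTop (𝓝 0) ∧
      (∀ᶠ n in atTop, 5 * κ n + 26 * G n + 3 * (α n * Real.log (models (p n) (u n)).card)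
        ≤ θ n * σsq * (c * n) / 8) ∧
      Tendsto (fun n => (models (p n) (u n)).card
        * Real.exp (((u n : ℝ) + 1) / 2 - G n / (4 * lam))) atTop (𝓝 0) := by
  have hsq := tendsto_sqrt_natCast_atTop
  set ℓ : ℕ → ℝ := fun n => (u n : ℝ) * Real.log (p n) with hℓ
  have hℓ0 : ∀ n, 0 ≤ ℓ n := fun n =>
    mul_nonneg (Nat.cast_nonneg _) (Real.log_natCast_nonneg _)
  have hℓo : ℓ =o[atTop] fun n : ℕ => √(n : ℝ) := by
    refine (isLittleO_iff_tendsto' ?_).2 hu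
    filter_upwards [eventually_gt_atTop 0] with n hn h
    exact absurd h (Real.sqrt_pos.2 (by exact_mod_cast hn)).ne'
  have h1o : (fun _ : ℕ => (1 : ℝ)) =o[atTop] fun n : ℕ => √(n : ℝ) :=
    (isLittleO_const_left.2 (Or.inr (tendsto_norm_atTop_atTop.comp hsq)))
  have hto : (fun n : ℕ => √√(n : ℝ)) =o[atTop] fun n : ℕ => √(n : ℝ) := by
    refine (isLittleO_iff_tendsto' ?_).2 ?_
    · filter_upwards [eventually_gt_atTop 0] with n hn h
      exact absurd h (Real.sqrt_pos.2 (by exact_mod_cast hn)).ne'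
    · have : ∀ n : ℕ, √√(n : ℝ) / √(n : ℝ) = (√√(n : ℝ))⁻¹ := fun n => Real.sqrt_div_self
      simp_rw [this]
      exact (Real.tendsto_sqrt_atTop.comp hsq).inv_tendsto_atTop
  -- In `G / (4 lam)` the first term beats the number of models, the second the dimension term `(u +
  -- 1)/2`, and `n^(1/4)` sends the remaining exponential to zero while being `o(√n)`.
  set G : ℕ → ℝ := fun n => 4 * lam * (ℓ n + (2 + ℓ n / Real.log 2) + √√(n : ℝ)) with hG
  have hl2 : 0 < Real.log 2 := Real.log_pos one_lt_two
  have hG0 : ∀ n, 0 ≤ G n := fun n => by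
    have := hℓ0 n
    have := div_nonneg this hl2.le
    positivity
  have hGo : G =o[atTop] fun n : ℕ => √(n : ℝ) := by
    refine IsLittleO.const_mul_left ((hℓo.add (IsLittleO.add ?_ ?_)).add hto) _
    · simpa using h1o.const_mul_left 2
    · simpa [div_eq_inv_mul] using hℓo.const_mul_left (Real.log 2)⁻¹
  -- The summand `1` keeps `ρ`, and hence `θ`, strictly positive; `θ` is then defined by `θ * σsq *
  -- c * n / 8 = ρ`.
  set ρ : ℕ → ℝ := fun n => 5 * |κ n| + 26 * G n + 3 * (|α n| * ℓ n) + 1 with hρ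
  have hρo : ρ =o[atTop] fun n : ℕ => √(n : ℝ) := by
    have h3 : (fun n => |α n| * ℓ n) =o[atTop] fun n : ℕ => √(n : ℝ) := by
      have := (hα.norm_left).mul_isLittleO hℓo
      simpa using this
    have h4 : (fun n => |κ n|) =o[atTop] fun n : ℕ => √(n : ℝ) := hκ.norm_left
    exact (((h4.const_mul_left 5).add (hGo.const_mul_left 26)).add (h3.const_mul_left 3)).add h1o
  have hρpos : ∀ n, 0 < ρ n := fun n => by
    have h1 := hG0 n
    have h2 := mul_nonneg (abs_nonneg (α n)) (hℓ0 n)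
    have h3 := abs_nonneg (κ n)
    simp only [hρ]; linarith
  refine ⟨G, fun n => 8 * ρ n / (σsq * (c * n)), hG0, ?_, ?_, ?_, ?_⟩
  · filter_upwards [eventually_gt_atTop 0] with n hn
    have : (0 : ℝ) < n := by exact_mod_cast hn
    have := hρpos n
    positivity
  · have h1 := (hρo.tendsto_div_nhds_zero).const_mul (8 / (σsq * c))
    rw [mul_zero] at h1
    refine h1.congr' ?_
    filter_upwards [eventually_gt_atTop 0] with n hn
    have hn' : (0 : ℝ) < n := by exact_mod_cast hn
    have hs : 0 < √(n : ℝ) := Real.sqrt_pos.2 hn'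
    have : (n : ℝ) = √(n : ℝ) * √(n : ℝ) := (Real.mul_self_sqrt hn'.le).symm
    generalize √(n : ℝ) = t at *
    rw [this]
    field_simp
  · filter_upwards [eventually_gt_atTop 0, hup] with n hn hu
    have hn' : (0 : ℝ) < n := by exact_mod_cast hn
    have e : 8 * ρ n / (σsq * (c * n)) * σsq * (c * n) / 8 = ρ n := by field_simp
    rw [e]
    obtain ⟨h1, h2⟩ := log_card_models_le hu
    have h3 : α n * Real.log (models (p n) (u n)).card ≤ |α n| * ℓ n :=
      mul_le_mul (le_abs_self _) h1 h2 (abs_nonneg _)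
    have h4 := le_abs_self (κ n)
    simp only [hρ]
    linarith
  · have ht : Tendsto (fun n : ℕ => Real.exp (-√√(n : ℝ))) atTop (𝓝 0) :=
      Real.tendsto_exp_neg_atTop_nhds_zero.comp (Real.tendsto_sqrt_atTop.comp hsq)
    refine squeeze_zero' (Eventually.of_forall fun n => by positivity) ?_ ht
    filter_upwards [hup] with n hu
    obtain ⟨h1, h2⟩ := log_card_models_le hu
    have hpos : 0 < ((models (p n) (u n)).card : ℝ) := by
      have hcard : (models (p n) (u n)).card = (p n).choose (u n) := by simp [models]
      rw [hcard]; exact_mod_cast Nat.choose_pos hu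
    nth_rewrite 1 [← Real.exp_log hpos]
    rw [← Real.exp_add]
    refine Real.exp_le_exp.2 ?_
    have h3 : G n / (4 * lam) = ℓ n + (2 + ℓ n / Real.log 2) + √√(n : ℝ) := by
      simp only [hG]; field_simp
    rw [h3]
    have h4 := natCast_le_of_le hu
    have h5 := hℓ0 n
    have h6 : 0 ≤ ℓ n / Real.log 2 := div_nonneg h5 hl2.le
    change (u n : ℝ) ≤ 1 + ℓ n / Real.log 2 at h4
    change _ ≤ ℓ n at h1
    linarith

/-- The differences are integers, so being eventually greater than `-1` is the same as being
eventually nonnegative. -/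
theorem eventually_le_of_liminf_sub_nonneg {u s : ℕ → ℕ}
    (h : 0 ≤ liminf (fun n => (((u n : ℝ) - (s n : ℝ) : ℝ) : EReal)) atTop) :
    ∀ᶠ n in atTop, s n ≤ u n := by
  have h1 : ((-1 : ℝ) : EReal) < liminf (fun n => (((u n : ℝ) - (s n : ℝ) : ℝ) : EReal)) atTop :=
    lt_of_lt_of_le (by exact_mod_cast (by norm_num : (-1 : ℝ) < 0)) h
  filter_upwards [eventually_lt_of_lt_liminf h1] with n hn
  have h2 : (-1 : ℝ) < (u n : ℝ) - s n := EReal.coe_lt_coe_iff.1 hn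
  have h3 : (s n : ℝ) < u n + 1 := by linarith
  exact Nat.lt_succ_iff.1 (by exact_mod_cast h3)

theorem exists_pos_const_mul_le {na : ℕ → ℕ}
    (h : (fun n => (na n : ℝ)) =Θ[atTop] fun n => (n : ℝ)) :
    ∃ c C : ℝ, 0 < c ∧ ∀ᶠ n : ℕ in atTop, c * n ≤ na n ∧ (na n : ℝ) ≤ C * n := by
  obtain ⟨C, -, hC⟩ := h.1.exists_pos
  obtain ⟨D, hD, hD'⟩ := h.2.exists_pos
  refine ⟨D⁻¹, C, inv_pos.2 hD, ?_⟩
  filter_upwards [hC.bound, hD'.bound] with n h1 h2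
  simp only [RCLike.norm_natCast] at h1 h2
  exact ⟨by rwa [inv_mul_le_iff₀ hD], h1⟩

theorem tendsto_exp_sub_sqrt {na : ℕ → ℕ} {c : ℝ} (hc : 0 < c)
    (h : ∀ᶠ n : ℕ in atTop, c * n ≤ na n) {d : ℝ} (hd : 0 < d) :
    Tendsto (fun n => Real.exp (1 / 4 - √(na n : ℝ) / d)) atTop (𝓝 0) := by
  have h1 : Tendsto (fun n => (na n : ℝ)) atTop atTop :=
    tendsto_atTop_mono' _ h (tendsto_natCast_atTop_atTop.const_mul_atTop hc)
  have h2 := (Real.tendsto_sqrt_atTop.comp h1).atTop_div_const hd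
  exact Real.tendsto_exp_atBot.comp
    (tendsto_const_nhds.add_atBot (tendsto_neg_atTop_atBot.comp h2))

/-- Every fluctuation is replaced by the common bound `x`, which leaves `(1 + x)³ < (1 + 11x)(1 -
x)²`. The difference is `6x - 24x² + 10x³`, positive for `x ≤ 1/10`; to first order any coefficient
above `5` in place of `11` would do. -/
theorem signal_dominates {σsq x K₁ K₂ K₃ K₄ q θ τ : ℝ} (hσ : 0 < σsq) (hx : 0 < x)
    (hx1 : x ≤ 1 / 10) (hK₁ : K₁ ≤ x) (hK₂ : K₂ ≤ x) (hK₃ : K₃ ≤ x) (hK₄ : K₄ ≤ x)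
    (hK₄0 : 0 ≤ K₄) (hθ0 : 0 ≤ θ)
    (hθ : θ ≤ x) (hq : q ≤ (1 + K₁) / (1 - K₂)) (hτ : σsq * (1 + 11 * x) ≤ τ) :
    q * (1 + θ) < (τ * (1 - K₃)) / (σsq * (1 + K₄)) := by
  have h1 : (1 + K₁) / (1 - K₂) ≤ (1 + x) / (1 - x) := by
    apply div_le_div₀ <;> linarith
  have h2 : q * (1 + θ) ≤ (1 + x) / (1 - x) * (1 + x) := by
    have h0 : 0 ≤ (1 + x) / (1 - x) := div_nonneg (by linarith) (by linarith)
    calc q * (1 + θ) ≤ (1 + x) / (1 - x) * (1 + θ) := by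
          gcongr; exact hq.trans h1
      _ ≤ _ := by gcongr
  have h3 : (1 + 11 * x) * (1 - x) / (1 + x) ≤ (τ * (1 - K₃)) / (σsq * (1 + K₄)) := by
    rw [div_le_div_iff₀ (by linarith) (by positivity)]
    have e1 : (1 + 11 * x) * (1 - x) * (σsq * (1 + K₄))
        = (σsq * (1 + 11 * x)) * ((1 - x) * (1 + K₄)) := by ring
    rw [e1, mul_assoc τ]
    have e2 : (1 - x) * (1 + K₄) ≤ (1 - K₃) * (1 + x) := by
      apply mul_le_mul <;> linarith
    refine mul_le_mul hτ e2 (mul_nonneg (by linarith) (by linarith)) ?_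
    exact le_trans (by positivity) hτ
  refine h2.trans_lt (lt_of_lt_of_le ?_ h3)
  rw [div_mul_eq_mul_div, div_lt_div_iff₀ (by linarith) (by linarith)]
  nlinarith [mul_pos hx hx, pow_pos hx 3]

-- The main theorem

theorem theorem2
    -- error variance, level of the test, numbers of rows of `A` and `B`
    (σsq δ : ℝ) (hσ : 0 < σsq) (hδ₀ : 0 < δ) (hδ₁ : δ < 1) (na nb : ℕ → ℕ)
    (hna : (fun n => (na n : ℝ)) =Θ[atTop] fun n => (n : ℝ))
    (hnb : (fun n => (nb n : ℝ)) =Θ[atTop] fun n => (n : ℝ)) :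
    ∃ h₀ : ℝ, 0 < h₀ ∧ ∀ h : ℝ, h₀ ≤ h →
      ∀ (p v r s u : ℕ → ℕ) (α : ℕ → ℝ)
        (Ω : ℕ → Type*) [∀ n, MeasurableSpace (Ω n)]
        -- the laws under the null hypothesis and under the alternative
        (P₀ P₁ : ∀ n, Measure (Ω n))
        (μ : ∀ n, Ω n → Fin n → ℝ)
        (X : ∀ n, Ω n → Matrix (Fin n) (Fin (p n)) ℝ)
        (Z : ∀ n, Ω n → Matrix (Fin n) (Fin (v n)) ℝ)
        (W : ∀ n, Ω n → Matrix (Fin n) (Fin (r n)) ℝ)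
        (A : ∀ n, Ω n → Matrix (Fin (na n)) (Fin n) ℝ)
        (B : ∀ n, Ω n → Matrix (Fin (nb n)) (Fin n) ℝ)
        (ν : ∀ n, Ω n → EuclideanSpace ℝ (Fin (v n)))
        (γ : ∀ n, Ω n → Fin (r n) → ℝ)
        (ε : ∀ n, Ω n → EuclideanSpace ℝ (Fin n))
        (Ψ₀ Ψ₁ : ∀ n, Matrix (Fin (v n)) (Fin (v n)) ℝ),
      -- the mixed model, with covariance `Ψ₀` of `ν` under `P₀` and `Ψ₁` under `P₁`
      (∀ n, IsMixedModel (P₀ n) (μ n) (X n) (Z n) (W n) (A n) (B n) (ν n) (γ n) (ε n)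
        (Ψ₀ n) σsq) →
      (∀ n, IsMixedModel (P₁ n) (μ n) (X n) (Z n) (W n) (A n) (B n) (ν n) (γ n) (ε n)
        (Ψ₁ n) σsq) →
      -- weak sparsity at rate `√n`
      WeaklySparse P₀ μ X s (fun n => √(n : ℝ)) →
      WeaklySparse P₁ μ X s (fun n => √(n : ℝ)) →
      -- the size `u` of the fitted models
      (∀ᶠ n in atTop, u n ≤ p n) →
      0 ≤ liminf (fun n => (((u n : ℝ) - (s n : ℝ) : ℝ) : EReal)) atTop →
      Tendsto (fun n => (u n : ℝ) * Real.log (p n) / √(n : ℝ)) atTop (𝓝 0) →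
      -- the largest eigenvalue of the noise covariance is bounded
      (∃ C : ℝ, ∀ᶠ n in atTop, ∀ᵐ ω ∂P₁ n,
        lamMax (stackQ (A n ω) (B n ω) * Z n ω * Ψ₁ n * (Z n ω)ᵀ * (stackQ (A n ω) (B n ω))ᵀ
          + σsq • (1 : Matrix (Fin (na n) ⊕ Fin (nb n)) (Fin (na n) ⊕ Fin (nb n)) ℝ)) ≤ C) →
      -- the temperature `α` is bounded and large enough
      α =O[atTop] (fun _ => (1 : ℝ)) →
      (∀ᶠ n in atTop, ∀ᵐ ω ∂P₁ n,
        6 * lamMax (stackQ (A n ω) (B n ω) * Z n ω * Ψ₁ n * (Z n ω)ᵀ * (stackQ (A n ω) (B n ω))ᵀ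
          + σsq • (1 : Matrix (Fin (na n) ⊕ Fin (nb n)) (Fin (na n) ⊕ Fin (nb n)) ℝ)) ≤ α n) →
      -- the null hypothesis and the contiguous alternative
      (∀ᶠ n in atTop, ∀ᵐ ω ∂P₀ n,
        lamMax (A n ω * Z n ω * Ψ₀ n * (Z n ω)ᵀ * (A n ω)ᵀ) = 0) →
      (∀ᶠ n in atTop, ∀ᵐ ω ∂P₁ n,
        lamMin (A n ω * Z n ω * Ψ₁ n * (Z n ω)ᵀ * (A n ω)ᵀ) = h / √(n : ℝ)) →
      -- type I error plus type II error is bounded away from zero and from one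
      ∃ c₁ c₂ : ℝ, 0 < c₁ ∧ c₂ < 1 ∧ ∀ᶠ n in atTop,
        (P₀ n).real {ω | Rejects (A n ω) (B n ω) (X n ω) (α n) (u n) δ
            (response (μ n ω) (Z n ω) (W n ω) (ν n ω) (γ n ω) (ε n ω))}
          + (P₁ n).real {ω | ¬ Rejects (A n ω) (B n ω) (X n ω) (α n) (u n) δ
            (response (μ n ω) (Z n ω) (W n ω) (ν n ω) (γ n ω) (ε n ω))} ∈ Set.Icc c₁ c₂ := by
  obtain ⟨ca, Ca, hca, hna'⟩ := exists_pos_const_mul_le hna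
  obtain ⟨cb, Cb, hcb, hnb'⟩ := exists_pos_const_mul_le hnb
  set c := min ca cb with hcdef
  have hc : 0 < c := lt_min hca hcb
  -- `η` is the budget for each individual error term, and `K` below is chosen so that one
  -- chi-square tail has probability at most `η`.
  set η := min δ (1 - δ) / 16 with hη
  have hmin : 0 < min δ (1 - δ) := lt_min hδ₀ (by linarith)
  have hη0 : 0 < η := by positivity
  have hη1 : 16 * η ≤ δ := by
    have := min_le_left δ (1 - δ); rw [hη]; linarith
  have hη2 : 16 * η ≤ 1 - δ := by
    have := min_le_right δ (1 - δ); rw [hη]; linarith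
  set K := 1 - 4 * Real.log η with hK
  have hK0 : 0 ≤ K := by
    have := Real.log_nonpos hη0.le (by linarith)
    linarith
  have hKη : Real.exp (1 / 4 - K / 4) = η := by
    rw [show 1 / 4 - K / 4 = Real.log η by rw [hK]; ring, Real.exp_log hη0]
  -- With `x = L / √n`, the first summand dominates the relative fluctuations `K/√n_a` and `K/√n_b`,
  -- and the `1` leaves room for `θ ≤ 1/√n`. The threshold `11 σsq L` then makes `h / √n ≥ 11 σsq
  -- x`.
  set L := K / √c + 1 with hL
  have hsc : 0 < √c := Real.sqrt_pos.2 hc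
  have hL1 : 1 ≤ L := by
    have : 0 ≤ K / √c := by positivity
    linarith
  refine ⟨σsq * (11 * L), by positivity, ?_⟩
  intro h hh p v r s u α Ω _ P₀ P₁ μ X Z W A B ν γ ε Ψ₀ Ψ₁ hM₀ hM₁ hS₀ hS₁ hup hus hulog hC hαO
    hα6 hH0 hH1
  obtain ⟨C, hC⟩ := hC
  obtain ⟨κ₀, hκ₀, hS₀⟩ := hS₀
  obtain ⟨κ₁, hκ₁, hS₁⟩ := hS₁
  set lam := max C σsq with hlam
  have hlam0 : 0 < lam := hσ.trans_le (le_max_right _ _)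
  obtain ⟨G, θ, hG0, hθ0, hθlim, hρ, hbad⟩ := exists_rates hc hσ hlam0
    (κ := fun n => |κ₀ n| + |κ₁ n|) (IsLittleO.add hκ₀.norm_left hκ₁.norm_left) hαO hup hulog
  have hsu := eventually_le_of_liminf_sub_nonneg hus
  have hnac : ∀ᶠ n : ℕ in atTop, c * n ≤ na n := hna'.mono fun n hn =>
    (mul_le_mul_of_nonneg_right (min_le_left _ _) (Nat.cast_nonneg n)).trans hn.1
  have hnbc : ∀ᶠ n : ℕ in atTop, c * n ≤ nb n := hnb'.mono fun n hn =>
    (mul_le_mul_of_nonneg_right (min_le_right _ _) (Nat.cast_nonneg n)).trans hn.1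
  have hsq := tendsto_sqrt_natCast_atTop
  -- the probability of the exceptional event
  have hbad' : ∀ᶠ n in atTop, 2 * ((models (p n) (u n)).card
      * Real.exp (((u n : ℝ) + 1) / 2 - G n / (4 * lam)))
      + (Real.exp (1 / 4 - √(na n : ℝ) / 8) + Real.exp (1 / 4 - √(nb n : ℝ) / 8)) ≤ η := by
    have := (hbad.const_mul 2).add ((tendsto_exp_sub_sqrt hc hnac (d := 8) (by norm_num)).add
      (tendsto_exp_sub_sqrt hc hnbc (d := 8) (by norm_num)))
    simp only [mul_zero, add_zero] at this
    exact this.eventually_le_const hη0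
  -- the effect of rescaling on the `F` distribution
  have hTV : ∀ᶠ n in atTop, √(Real.exp (na n * (θ n ^ 2 / 2)) - 1) ≤ η := by
    have h1 : Tendsto (fun n : ℕ => √(Real.exp (Ca * ((√(n : ℝ) * θ n) ^ 2 / 2)) - 1)) atTop
        (𝓝 (√(Real.exp (Ca * (0 ^ 2 / 2)) - 1))) :=
      ((Real.continuous_exp.tendsto _).comp
        (((hθlim.pow 2).div_const 2).const_mul Ca)).sub_const 1 |>.sqrt
    rw [show √(Real.exp (Ca * (0 ^ 2 / 2)) - 1) = 0 by simp] at h1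
    filter_upwards [h1.eventually_le_const hη0, hna'] with n hn hn2
    refine le_trans (Real.sqrt_le_sqrt (sub_le_sub_right (Real.exp_le_exp.2 ?_) 1)) hn
    rw [mul_pow, Real.sq_sqrt (Nat.cast_nonneg _)]
    calc (na n : ℝ) * (θ n ^ 2 / 2) ≤ (Ca * n) * (θ n ^ 2 / 2) := by
          gcongr; exact hn2.2
      _ = _ := by ring
  -- The type I error lies between `δ - 3η` (two rescalings and the exceptional event) and `δ + 2η`;
  -- the type II error is at most `4η` (three tails and the exceptional event).
  refine ⟨δ - 3 * η, δ + 6 * η, by linarith, by linarith, ?_⟩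
  filter_upwards [hsu, hup, hS₀, hS₁, hC, hα6, hH0, hH1, hnac, hnbc, hbad', hTV, hρ, hθ0,
    eventually_gt_atTop 0, hθlim.eventually_le_const (show (0 : ℝ) < 1 by norm_num),
    hsq.eventually_ge_atTop (10 * L),
    (tendsto_exp_sub_sqrt hc hnac (d := 4) (by norm_num)).eventually_le_const hη0,
    (tendsto_exp_sub_sqrt hc hnbc (d := 4) (by norm_num)).eventually_le_const hη0]
    with n hsu hup hS₀ hS₁ hC hα6 hH0 hH1 hnac hnbc hbad hTV hρ hθ0 hn hθ1 hnL hea heb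
  have hn' : (0 : ℝ) < n := by exact_mod_cast hn
  have hna0 : 0 < na n := by
    have : (0 : ℝ) < na n := lt_of_lt_of_le (by positivity) hnac
    exact_mod_cast this
  have hnb0 : 0 < nb n := by
    have : (0 : ℝ) < nb n := lt_of_lt_of_le (by positivity) hnbc
    exact_mod_cast this
  have hsn : 0 < √(n : ℝ) := Real.sqrt_pos.2 hn'
  have := (hM₁ n).isProbabilityMeasure
  set x := L / √(n : ℝ) with hx
  have hx0 : 0 < x := by positivity
  have hx1 : x ≤ 1 / 10 := by
    rw [hx, div_le_iff₀ hsn]; linarith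
  have hθx : θ n ≤ x := by
    rw [hx, le_div_iff₀ hsn]; linarith
  have hKx : ∀ k : ℕ, c * n ≤ k → K / √(k : ℝ) ≤ x := by
    intro k hk
    have h1 : √c * √(n : ℝ) ≤ √(k : ℝ) := by
      rw [← Real.sqrt_mul hc.le]; exact Real.sqrt_le_sqrt hk
    calc K / √(k : ℝ) ≤ K / (√c * √(n : ℝ)) := by gcongr
      _ = K / √c / √(n : ℝ) := by rw [div_div]
      _ ≤ x := by rw [hx]; gcongr; linarith
  -- covariance bounds
  have hpsd : ∀ ω, (noiseCov (stackQ (A n ω) (B n ω)) (Z n ω) (Ψ₁ n) σsq).PosSemidef := fun ω =>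
    posSemidef_noiseCov _ _ (hM₁ n).posSemidef hσ.le
  -- A unit vector in the `A` block has quadratic form at least `σsq`, so `lamMax`, and with it `α
  -- n`, is positive.
  have hα0 : 0 < α n := by
    obtain ⟨ω, hω⟩ := hα6.exists
    change 6 * lamMax (noiseCov (stackQ (A n ω) (B n ω)) (Z n ω) (Ψ₁ n) σsq) ≤ α n at hω
    have h1 := quadForm_le_lamMax (hpsd ω).1 (Sum.elim (Pi.single ⟨0, hna0⟩ 1) 0)
    rw [← quadForm_noiseCov_stackQ_inl, sqNorm_sumElim] at h1
    have h2 := (hM₁ n).le_quadForm_noiseCov_A ω (Pi.single ⟨0, hna0⟩ 1)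
    have h3 : sqNorm (Pi.single (⟨0, hna0⟩ : Fin (na n)) (1 : ℝ)) = 1 := by
      simp [sqNorm, Pi.single_apply]
    have h4 : sqNorm (0 : Fin (nb n) → ℝ) = 0 := by simp [sqNorm]
    rw [h3] at h1 h2
    rw [h4] at h1
    linarith
  have hA1 : ∀ᵐ ω ∂P₁ n, ∀ w, w ⬝ᵥ noiseCov (A n ω) (Z n ω) (Ψ₁ n) σsq *ᵥ w
      ≤ lam * sqNorm w := by
    filter_upwards [hC] with ω hω w
    have h1 := quadForm_le_lamMax (hpsd ω).1 (Sum.elim w 0)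
    rw [← quadForm_noiseCov_stackQ_inl, sqNorm_sumElim] at h1
    have h4 : sqNorm (0 : Fin (nb n) → ℝ) = 0 := by simp [sqNorm]
    rw [h4, add_zero] at h1
    exact h1.trans (mul_le_mul_of_nonneg_right (hω.trans (le_max_left _ _)) (sqNorm_nonneg w))
  have hA1' : ∀ᵐ ω ∂P₁ n, ∀ w, (σsq + h / √(n : ℝ)) * sqNorm w
      ≤ w ⬝ᵥ noiseCov (A n ω) (Z n ω) (Ψ₁ n) σsq *ᵥ w := by
    filter_upwards [hH1] with ω hω w
    have h1 := lamMin_le_quadForm (posSemidef_signalCov (A n ω) (Z n ω) (hM₁ n).posSemidef).1 w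
    rw [hω] at h1
    rw [noiseCov, add_mulVec, dotProduct_add, smul_one_quadForm]
    linarith
  have hA0 : ∀ᵐ ω ∂P₀ n, A n ω * Z n ω * Ψ₀ n * (Z n ω)ᵀ * (A n ω)ᵀ = 0 := by
    filter_upwards [hH0] with ω hω
    exact eq_zero_of_lamMax_eq_zero (posSemidef_signalCov _ _ (hM₀ n).posSemidef) hω
  have hA0' : ∀ᵐ ω ∂P₀ n, ∀ w, w ⬝ᵥ noiseCov (A n ω) (Z n ω) (Ψ₀ n) σsq *ᵥ w
      ≤ lam * sqNorm w := by
    filter_upwards [hA0] with ω hω w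
    rw [noiseCov, hω, zero_add, smul_one_quadForm]
    exact mul_le_mul_of_nonneg_right (le_max_right _ _) (sqNorm_nonneg w)
  have hρ' : ∀ k : ℕ, c * n ≤ k → 5 * (|κ₀ n| + |κ₁ n|) + 26 * G n
      + 3 * (α n * Real.log (models (p n) (u n)).card) ≤ θ n * σsq * k / 8 := fun k hk =>
    hρ.trans (by gcongr)
  -- comparison of the test statistic with the ratio of the mean squares of the noise
  have hclose₀ := ((hM₀ n).real_not_close_le hσ hna0 hnb0 hsu hup hα0 (le_max_right C σsq) (hG0 n)
    hθ0.le (by linarith) (hS₀.mono fun ω ⟨m, hm, hle⟩ => ⟨m, hm, hle.trans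
      ((le_abs_self _).trans (le_add_of_nonneg_right (abs_nonneg _)))⟩) hA0'
    (hρ' _ hnac) (hρ' _ hnbc)).trans hbad
  have hclose₁ := ((hM₁ n).real_not_close_le hσ hna0 hnb0 hsu hup hα0 (le_max_right C σsq) (hG0 n)
    hθ0.le (by linarith) (hS₁.mono fun ω ⟨m, hm, hle⟩ => ⟨m, hm, hle.trans
      ((le_abs_self _).trans (le_add_of_nonneg_left (abs_nonneg _)))⟩) hA1
    (hρ' _ hnac) (hρ' _ hnbc)).trans hbad
  -- the quantile
  have hKnb := hKx _ hnbc
  have hKna := hKx _ hnac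
  have hsnb : 0 < √(nb n : ℝ) := Real.sqrt_pos.2 (by exact_mod_cast hnb0)
  -- If the quantile were nonpositive, the mass of the positive half-line would be at most `δ`, but
  -- it is at least `1 - 2η`.
  have hqpos : 0 < fUpperQuantile (na n) (nb n) δ := by
    by_contra! hq
    have h1 := fDist_Ioi_zero_ge hna0 hnb0
    have h2 := measureReal_mono (μ := fDist (na n) (nb n)) (Set.Ioi_subset_Ioi hq)
    have h3 := fDist_Ioi_fUpperQuantile_le (a := na n) (b := nb n) hδ₀
    linarith
  have hqle : fUpperQuantile (na n) (nb n) δ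
      ≤ (1 + K / √(na n : ℝ)) / (1 - K / √(nb n : ℝ)) := by
    refine fUpperQuantile_le hδ₁ ((fDist_Ioi_le hna0 hnb0 hK0 ?_).trans ?_)
    · rw [← div_lt_one hsnb]; linarith
    · rw [hKη]; linarith
  -- the error probabilities
  have hI := (hM₀ n).typeI_error_bounds hσ hδ₀ hδ₁ hA0 hqpos hθ0 hclose₀
  have hτ : σsq * (1 + 11 * x) ≤ σsq + h / √(n : ℝ) := by
    have h1 : σsq * (11 * x) ≤ h / √(n : ℝ) := by
      rw [le_div_iff₀ hsn, hx, mul_assoc, mul_assoc, div_mul_cancel₀ _ hsn.ne']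
      exact hh
    linarith
  have hII := (hM₁ n).typeII_error_le hσ hna0 hnb0 (τ := σsq + h / √(n : ℝ)) (K := K) hθ0
    (lt_of_lt_of_le (by positivity) hτ) hA1' hK0
    (signal_dominates hσ hx0 hx1 hKna hKnb hKna hKnb (by positivity) hθ0.le hθx
      hqle hτ) hclose₁
  rw [hKη] at hII
  have h0 : 0 ≤ (P₁ n).real {ω | ¬ Rejects (A n ω) (B n ω) (X n ω) (α n) (u n) δ
    (response (μ n ω) (Z n ω) (W n ω) (ν n ω) (γ n ω) (ε n ω))} := measureReal_nonneg
  simp only [Rejects] at h0 ⊢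
  exact ⟨by linarith [hI.2], by linarith [hI.1]⟩
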